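/- Let $g>0$ and let $U,\rho_0\in C^3(\mathbb R)$ be real functions such that $U',U'',\rho_0',\rho_0''\to 0$ as $|y|\to\infty$, $\rho_0>0$ on $\mathbb R$, and $\rho_0(y)\to\rho_\pm$ as $y\to\pm\infty$ with $\rho_\pm>0$. Suppose that $U'(y)\neq 0$ and $\rho_0'(y)>0$ for all $y\in\mathbb R$. Then for every integer $k\ge 1$ there is $\varepsilon_0>0$ such that for every real $\varepsilon$ with $|\varepsilon|<\varepsilon_0$ the Rayleigh system at the state $(\varepsilon U,\rho_0)$, $$k^2\rho_0\phi-(\rho_0\phi')'+\frac{(\rho_0\,\varepsilon U')'}{\varepsilon U-c}\,\phi=-\frac{g\rho_0'}{(\varepsilon U-c)^2}\,\phi,\qquad (\varepsilon U-c)\,r+\phi\,\rho_0'=0\qquad\text{on }\mathbb R,$$ has a solution $(c,\phi,r)$ with $c\in\mathbb C$, $\operatorname{Im}c>0$, $\phi,r:\mathbb R\to\mathbb C$, $\phi\not\equiv 0$, $\phi\in C^2(\mathbb R)\cap H^2(\mathbb R)$ and $r\in H^1(\mathbb R)$. Moreover, if $U$ and $\rho_0$ are $C^\infty$ and all their derivatives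 of order at least $1$ are bounded on $\mathbb R$, then this solution satisfies $\phi,r\in H^m(\mathbb R)$ for every real $m>0$. -/

import Mathlib

open Filter Topology MeasureTheory
open scoped ContDiff SchwartzMap

/-- `f : ℝ → ℂ` belongs to the Sobolev space `H^s(ℝ)`, `s ≥ 0`: it is square integrable and the
tempered distribution it represents lies in the Bessel potential space of order `s`. -/
def InSobolev (s : ℝ) (f : ℝ → ℂ) : Prop :=
  ∃ hf : MemLp f 2 (volume : Measure ℝ),
    TemperedDistribution.MemSobolev s 2
      (((hf.toLp f : Lp ℂ 2 (volume : Measure ℝ))) : 𝓢'(ℝ, ℂ))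

/-- `f` is smooth and all its derivatives of order at least one are bounded
(`f` itself may be unbounded). -/
def SmoothWithBoundedDerivs (f : ℝ → ℝ) : Prop :=
  ContDiff ℝ ∞ f ∧ ∀ n : ℕ, 1 ≤ n → ∃ C : ℝ, ∀ y : ℝ, |iteratedDeriv n f y| ≤ C

/-- `(c, φ, r)` is a nontrivial classical solution of the full Rayleigh system at the state
`(V, ρ)`, with gravitational acceleration `g` and horizontal wave number `k`:
`k² ρ φ - (ρ φ')' + (ρ V')' / (V - c) φ = - g ρ' / (V - c)² φ` and `(V - c) r + φ ρ' = 0`. -/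
structure IsRayleighSolution (g : ℝ) (k : ℕ) (V ρ : ℝ → ℝ) (c : ℂ) (φ r : ℝ → ℂ) : Prop where
  ne_zero : φ ≠ 0
  noncritical : ∀ y : ℝ, (V y : ℂ) - c ≠ 0
  contDiff : ContDiff ℝ 2 φ
  momentum : ∀ y : ℝ,
    (k : ℂ) ^ 2 * (ρ y : ℂ) * φ y - deriv (fun z : ℝ => (ρ z : ℂ) * deriv φ z) y
        + ((deriv (fun z : ℝ => ρ z * deriv V z) y : ℝ) : ℂ) / ((V y : ℂ) - c) * φ y
      = -(((g * deriv ρ y : ℝ) : ℂ) / ((V y : ℂ) - c) ^ 2 * φ y)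
  density : ∀ y : ℝ, ((V y : ℂ) - c) * r y + φ y * ((deriv ρ y : ℝ) : ℂ) = 0

/-!
Why the theorem is true. Write `φ = S f`, where `S = (d/dy + k)⁻¹` is convolution with the
exponential kernel and `f ∈ L²(ℝ; ℂ)`; this parametrises `H¹`. In weak form the Rayleigh equation
becomes `(L + S† q S) f = 0`, where `L = energyOp` is the bounded, coercive, self-adjoint operator of
the form `∫ ρ₀ (|φ'|² + k² |φ|²)`, and `q = ε (ρ₀ U')' / (ε U - c) + g ρ₀' / (ε U - c)²` acts by
multiplication. Since `q` vanishes at infinity, `S† q S` is compact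
(`potentialOp_isCompactOperator`), so by the Fredholm alternative a solution exists as soon as
`L + S† q S` is not invertible.

For `ε = 0` the operator is `L + c⁻² B` with `B = S† (g ρ₀') S` compact, positive and nonzero, because
`ρ₀' > 0`. The spectral theorem applied to `L^(-1/2) B L^(-1/2)` gives `μ > 0` and `v ≠ 0` with
`B v = μ L v` (`exists_pos_pencil_eigenvalue`), so that `c₀ = i √μ` is an unstable mode of the fluid
at rest. The eigenvalues of the pencil are real and countable in number, hence some small circle
around `c₀` contains only points `c` at which `L + c⁻² B` is invertible.

As `ε → 0` the operators converge in norm, uniformly for `c` in the disc: where `U` may be unbounded,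
`ρ₀'` is small (`rayleighPotential_sub_le`). If for some small `ε` all operators of the disc were
invertible, the maximum principle for the holomorphic inverse would bound the inverse at `c₀` by
its values on the circle, uniformly in `ε`, whereas the operator at `c₀` nearly annihilates `v`
(`exists_not_isUnit_of_perturbation`). So the disc, which lies in the upper half plane, contains an
eigenvalue `c`. No simplicity of the eigenvalue is needed.

A kernel vector is a classical solution by bootstrap (`exists_classical_solution_of_kernel`): with
`p = ρ₀ φ'` the equation is the system `φ' = p / ρ₀`, `p' = (k² ρ₀ + q) φ`. Combinations `a φ + b p`
whose coefficients have bounded derivatives are stable under differentiation, which gives every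
Sobolev order that the smoothness of the coefficients permits (`inSobolev_of_system`).
-/

open scoped BoundedContinuousFunction

/-! ### Operator pencils in a Hilbert space -/

open Module.End in
/-- Fredholm alternative for a compact perturbation of an invertible operator. -/
theorem exists_ne_zero_of_not_isUnit_add_compact {E : Type*} [NormedAddCommGroup E]
    [NormedSpace ℂ E] [CompleteSpace E] {L C : E →L[ℂ] E} (hL : IsUnit L)
    (hC : IsCompactOperator C) (h : ¬ IsUnit (L + C)) : ∃ v : E, v ≠ 0 ∧ (L + C) v = 0 := by
  obtain ⟨l, rfl⟩ := hL
  let T : E →L[ℂ] E := (↑l⁻¹ : E →L[ℂ] E) * C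
  have hT : IsCompactOperator T := hC.clm_comp (↑l⁻¹ : E →L[ℂ] E)
  have hfac : (l : E →L[ℂ] E) + C = (l : E →L[ℂ] E) * (1 + T) := by
    simp [T, mul_add]
  rcases hT.hasEigenvalue_or_mem_resolventSet (μ := -1) (by norm_num) with h1 | h1
  · obtain ⟨v, hv, hv0⟩ := h1.exists_hasEigenvector
    refine ⟨v, hv0, ?_⟩
    have hv' : T v = -v := by simpa using mem_eigenspace_iff.1 hv
    simp [hfac, hv']
  · refine absurd ?_ h
    rw [hfac]
    refine l.isUnit.mul ?_
    rw [spectrum.mem_resolventSet_iff, ← IsUnit.neg_iff] at h1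
    convert h1 using 1
    simp; abel

/-- A kernel vector at the centre of a disc persists, as a point of non-invertibility
somewhere in the disc, under uniformly small perturbations of a holomorphic operator family that is
invertible on the boundary circle. -/
theorem exists_not_isUnit_of_perturbation {E : Type*} [NormedAddCommGroup E]
    [NormedSpace ℂ E] [CompleteSpace E] {X : ℝ → ℂ → E →L[ℂ] E} {z₀ : ℂ} {r : ℝ} (hr : 0 < r)
    (hX : ∀ ε, DiffContOnCl ℂ (X ε) (Metric.ball z₀ r))
    (hlim : ∀ η > 0, ∃ ε₀ > 0, ∀ ε : ℝ, |ε| < ε₀ → ∀ z ∈ Metric.closedBall z₀ r,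
      ‖X ε z - X 0 z‖ ≤ η)
    (hunit : ∀ z ∈ Metric.sphere z₀ r, IsUnit (X 0 z))
    {v : E} (hv : v ≠ 0) (hv0 : X 0 z₀ v = 0) :
    ∃ ε₀ > 0, ∀ ε : ℝ, |ε| < ε₀ → ∃ z ∈ Metric.closedBall z₀ r, ¬ IsUnit (X ε z) := by
  have hcl : closure (Metric.ball z₀ r) = Metric.closedBall z₀ r := closure_ball _ hr.ne'
  have hcont : ContinuousOn (fun z => Ring.inverse (X 0 z)) (Metric.sphere z₀ r) := by
    intro z hz
    have h1 : ContinuousWithinAt (X 0) (Metric.sphere z₀ r) z :=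
      ((hX 0).continuousOn z (hcl ▸ Metric.sphere_subset_closedBall hz)).mono
        (hcl ▸ Metric.sphere_subset_closedBall)
    obtain ⟨u, hu⟩ := hunit z hz
    exact ContinuousAt.comp_continuousWithinAt
      (by rw [← hu]; exact NormedRing.inverse_continuousAt u) h1
  obtain ⟨M, hM⟩ := (isCompact_sphere z₀ r).exists_bound_of_continuousOn hcont
  -- a strictly positive bound for the inverses on the circle
  set M' := max M 1 with hM'
  have hM'pos : 0 < M' := lt_of_lt_of_le one_pos (le_max_right _ _)
  -- a perturbation of size `1 / (4 M')` at most doubles the inverses on the circle, and bounds the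
  -- image of `v` by half of what an inverse of norm `2 M'` would allow
  obtain ⟨ε₀, hε₀, hε⟩ := hlim (1 / (4 * M')) (by positivity)
  refine ⟨ε₀, hε₀, fun ε he => ?_⟩
  by_contra! hcon
  have hinv : DiffContOnCl ℂ (fun z => Ring.inverse (X ε z)) (Metric.ball z₀ r) := by
    refine ⟨fun z hz => ?_, fun z hz => ?_⟩
    · obtain ⟨u, hu⟩ := hcon z (Metric.ball_subset_closedBall hz)
      have h1 : DifferentiableAt ℂ Ring.inverse (X ε z) := by
        rw [← hu]; exact differentiableAt_inverse u.isUnit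
      exact h1.comp_differentiableWithinAt z ((hX ε).differentiableOn z hz)
    · obtain ⟨u, hu⟩ := hcon z (hcl ▸ hz)
      have h1 : ContinuousAt Ring.inverse (X ε z) := by
        rw [← hu]; exact NormedRing.inverse_continuousAt u
      exact h1.comp_continuousWithinAt ((hX ε).continuousOn z hz)
  have hbd : ∀ z ∈ frontier (Metric.ball z₀ r), ‖Ring.inverse (X ε z)‖ ≤ 2 * M' := by
    intro z hz
    rw [frontier_ball _ hr.ne'] at hz
    have hzc := Metric.sphere_subset_closedBall hz
    refine ContinuousLinearMap.opNorm_le_bound _ (by positivity) fun y => ?_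
    set w := Ring.inverse (X ε z) y with hw
    have hXw : X ε z w = y := by
      rw [hw, ← mul_apply_eq_comp, Ring.mul_inverse_cancel _ (hcon z hzc)]; rfl
    have h0 : Ring.inverse (X 0 z) (X 0 z w) = w := by
      rw [← mul_apply_eq_comp, Ring.inverse_mul_cancel _ (hunit z hz)]; rfl
    have h1 : ‖w‖ ≤ M' * ‖X 0 z w‖ := by
      conv_lhs => rw [← h0]
      exact (ContinuousLinearMap.le_opNorm _ _).trans
        (mul_le_mul_of_nonneg_right ((hM z hz).trans (le_max_left _ _)) (norm_nonneg _))
    have h2 : ‖X 0 z w‖ ≤ ‖y‖ + 1 / (4 * M') * ‖w‖ := by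
      have : X 0 z w = y - (X ε z - X 0 z) w := by simp [hXw]
      rw [this]
      exact (norm_sub_le _ _).trans (add_le_add le_rfl
        (ContinuousLinearMap.le_of_opNorm_le _ (hε ε he z hzc) _))
    have h3 : M' * (1 / (4 * M') * ‖w‖) = ‖w‖ / 4 := by field_simp
    nlinarith [norm_nonneg w, mul_le_mul_of_nonneg_left h2 hM'pos.le, norm_nonneg y]
  have hmax := Complex.norm_le_of_forall_mem_frontier_norm_le Metric.isBounded_ball hinv hbd
    (subset_closure (Metric.mem_ball_self hr))
  have hzc : z₀ ∈ Metric.closedBall z₀ r := Metric.mem_closedBall_self hr.le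
  have h0 : Ring.inverse (X ε z₀) (X ε z₀ v) = v := by
    rw [← mul_apply_eq_comp, Ring.inverse_mul_cancel _ (hcon z₀ hzc)]; rfl
  have h1 : ‖v‖ ≤ 2 * M' * ‖X ε z₀ v‖ := by
    conv_lhs => rw [← h0]
    exact ContinuousLinearMap.le_of_opNorm_le _ hmax _
  have h2 : ‖X ε z₀ v‖ ≤ 1 / (4 * M') * ‖v‖ := by
    have : X ε z₀ v = (X ε z₀ - X 0 z₀) v := by simp [hv0]
    rw [this]
    exact ContinuousLinearMap.le_of_opNorm_le _ (hε ε he z₀ hzc) _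
  have h3 : 2 * M' * (1 / (4 * M') * ‖v‖) = ‖v‖ / 2 := by field_simp; norm_num
  have := norm_pos_iff.2 hv
  nlinarith [mul_le_mul_of_nonneg_left h2 (by positivity : 0 ≤ 2 * M')]

section SelfAdjointPencil

variable {E : Type*} [NormedAddCommGroup E] [InnerProductSpace ℂ E]

open ContinuousLinearMap in
/-- A positive compact nonzero `B` has a positive eigenvalue relative to a positive invertible `L`,
obtained as an eigenvalue of `L^(-1/2) B L^(-1/2)`. -/
theorem exists_pos_pencil_eigenvalue [CompleteSpace E] {L B : E →L[ℂ] E} (hL : L.IsPositive) (hLu : IsUnit L)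
    (hB : B.IsPositive) (hBc : IsCompactOperator B) (hB0 : B ≠ 0) :
    ∃ μ : ℝ, 0 < μ ∧ ∃ v : E, v ≠ 0 ∧ B v = (μ : ℂ) • L v := by
  have hL0 : 0 ≤ L := (nonneg_iff_isPositive L).2 hL
  obtain ⟨R, hR⟩ : IsUnit (CFC.sqrt L) := (CFC.isUnit_sqrt_iff L).2 hLu
  have hRR : (R : E →L[ℂ] E) * R = L := by rw [hR]; exact CFC.sqrt_mul_sqrt_self L
  have hRsa : IsSelfAdjoint (R : E →L[ℂ] E) := by
    rw [hR]; exact IsSelfAdjoint.of_nonneg (CFC.sqrt_nonneg L)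
  set Q : E →L[ℂ] E := ↑R⁻¹ with hQ
  have hQsa : adjoint Q = Q := by
    have h1 : star (R : E →L[ℂ] E) * star Q = 1 := by rw [← star_mul]; simp [hQ]
    rw [hRsa.star_eq] at h1
    calc adjoint Q = Q * (R * star Q) := by rw [← mul_assoc]; simp [hQ, star_eq_adjoint]
      _ = Q := by rw [h1, mul_one]
  set A : E →L[ℂ] E := Q * B * Q with hA
  have hAc : IsCompactOperator A := (hBc.clm_comp Q).comp_clm Q
  have hApos : A.IsPositive := by
    have := hB.conj_adjoint Q
    rwa [hQsa, ← ContinuousLinearMap.comp_assoc] at this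
  have hA0 : A ≠ 0 := by
    intro h
    apply hB0
    calc B = R * A * R := by simp [hA, hQ, mul_assoc]
      _ = 0 := by rw [h]; simp
  have hne := (eq_zero_of_forall_hasEigenvalue_eq_zero hAc hApos.isSymmetric).not.2 hA0
  push Not at hne
  obtain ⟨ν, hν, hν0⟩ := hne
  obtain ⟨v, hv, hv0⟩ := hν.exists_hasEigenvector
  have hvA : A v = ν • v := Module.End.mem_eigenspace_iff.1 hv
  have hνre : (starRingEnd ℂ) ν = ν := LinearMap.IsSymmetric.conj_eigenvalue_eq_self
    hApos.isSymmetric hν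
  have hνeq : ((ν.re : ℝ) : ℂ) = ν := Complex.conj_eq_iff_re.1 hνre
  have hν1 : Module.End.HasEigenvalue (A : Module.End ℂ E) ((ν.re : ℝ) : ℂ) := by rwa [hνeq]
  have hνnn : 0 ≤ ν.re := eigenvalue_nonneg_of_nonneg (𝕜 := ℂ) hν1
    (fun x => hApos.re_inner_nonneg_right x)
  refine ⟨ν.re, lt_of_le_of_ne hνnn fun h => hν0 (by rw [← hνeq, ← h]; simp), Q v, ?_, ?_⟩
  · intro h
    apply hv0
    calc v = ((R : E →L[ℂ] E) * Q) v := by simp [hQ]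
      _ = 0 := by simp [h]
  · have h1 : B (Q v) = (R : E →L[ℂ] E) (A v) := by
      change _ = ((R : E →L[ℂ] E) * A) v
      simp [hA, hQ, ← mul_assoc]
    have h2 : L (Q v) = (R : E →L[ℂ] E) v := by
      rw [← hRR]
      change ((R : E →L[ℂ] E) * R * Q) v = _
      simp [hQ, mul_assoc]
    rw [h1, h2, hvA, hνeq, map_smul]

/-- Eigenvalues of a symmetric pencil with coercive `L` are real. -/
theorem pencil_eigenvalue_conj {L B : E →L[ℂ] E} (hL : L.IsPositive) {m : ℝ} (hm : 0 < m)
    (hcoer : ∀ v, m * ‖v‖ ^ 2 ≤ RCLike.re (inner ℂ (L v) v)) (hB : B.IsPositive)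
    {μ : ℂ} {v : E} (hv : v ≠ 0) (h : B v = μ • L v) : (starRingEnd ℂ) μ = μ := by
  have h1 : inner ℂ (B v) v = inner ℂ v (B v) := hB.isSymmetric v v
  have h2 : inner ℂ (L v) v = inner ℂ v (L v) := hL.isSymmetric v v
  rw [h, inner_smul_left, inner_smul_right, ← h2] at h1
  refine mul_right_cancel₀ (fun h0 => ?_) h1
  have h3 := hcoer v
  rw [h0, map_zero] at h3
  have := norm_pos_iff.2 hv
  nlinarith [pow_pos this 2]

/-- The real eigenvalues of a symmetric pencil with coercive `L` on a separable space are
countable, because eigenvectors for distinct eigenvalues are orthogonal for `⟪L ·, ·⟫`. -/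
theorem countable_pencil_eigenvalues [TopologicalSpace.SeparableSpace E] {L B : E →L[ℂ] E}
    (hL : L.IsPositive) {m : ℝ} (hm : 0 < m)
    (hcoer : ∀ v, m * ‖v‖ ^ 2 ≤ RCLike.re (inner ℂ (L v) v)) (hB : B.IsPositive) :
    {μ : ℝ | ∃ v : E, v ≠ 0 ∧ B v = (μ : ℂ) • L v}.Countable := by
  set s := {μ : ℝ | ∃ v : E, v ≠ 0 ∧ B v = (μ : ℂ) • L v} with hs
  have hex : ∀ μ : ℝ, ∃ v : E, μ ∈ s → ‖v‖ = 1 ∧ B v = (μ : ℂ) • L v := by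
    intro μ
    by_cases h : μ ∈ s
    · obtain ⟨v, hv, hB⟩ := h
      refine ⟨((‖v‖⁻¹ : ℝ) : ℂ) • v, fun _ => ⟨?_, ?_⟩⟩
      · rw [norm_smul]; simp [norm_ne_zero_iff.2 hv]
      · rw [map_smul, map_smul, hB, smul_comm]
    · exact ⟨0, fun h' => absurd h' h⟩
  choose v hv using hex
  have hsep : ∀ μ ∈ s, ∀ ν ∈ s, μ ≠ ν → m ≤ ‖L‖ * ‖v μ - v ν‖ ^ 2 := by
    intro μ hμ ν hν hne
    have h1 : inner ℂ (B (v μ)) (v ν) = inner ℂ (v μ) (B (v ν)) := hB.isSymmetric _ _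
    have hLs : inner ℂ (L (v μ)) (v ν) = inner ℂ (v μ) (L (v ν)) := hL.isSymmetric _ _
    rw [(hv μ hμ).2, (hv ν hν).2, inner_smul_left, inner_smul_right, ← hLs,
      Complex.conj_ofReal, ← sub_eq_zero, ← sub_mul, mul_eq_zero] at h1
    have h0 : inner ℂ (L (v μ)) (v ν) = 0 := h1.resolve_left
      (by rw [← Complex.ofReal_sub]; exact_mod_cast sub_ne_zero.2 hne)
    have h0' : inner ℂ (L (v ν)) (v μ) = 0 := by
      have hLs : inner ℂ (L (v ν)) (v μ) = inner ℂ (v ν) (L (v μ)) := hL.isSymmetric _ _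
      rw [hLs, ← inner_conj_symm, h0, map_zero]
    have h2 : RCLike.re (inner ℂ (L (v μ - v ν)) (v μ - v ν)) =
        RCLike.re (inner ℂ (L (v μ)) (v μ)) + RCLike.re (inner ℂ (L (v ν)) (v ν)) := by
      rw [map_sub, inner_sub_left, inner_sub_right, inner_sub_right, h0, h0']
      simp
    have h3 : RCLike.re (inner ℂ (L (v μ - v ν)) (v μ - v ν)) ≤ ‖L‖ * ‖v μ - v ν‖ ^ 2 := by
      refine (RCLike.re_le_norm _).trans ((norm_inner_le_norm _ _).trans ?_)
      rw [pow_two, ← mul_assoc]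
      exact mul_le_mul_of_nonneg_right (L.le_opNorm _) (norm_nonneg _)
    have h4 := hcoer (v μ)
    have h5 := hcoer (v ν)
    rw [(hv μ hμ).1] at h4
    rw [(hv ν hν).1] at h5
    linarith
  -- balls of half the separation radius around the normalised eigenvectors are disjoint
  obtain ⟨d, hd, hdm⟩ : ∃ d : ℝ, 0 < d ∧ ‖L‖ * (2 * d) ^ 2 < m := by
    refine ⟨min 1 (m / (8 * (‖L‖ + 1))), by positivity, ?_⟩
    set d := min 1 (m / (8 * (‖L‖ + 1))) with hd
    have hd0 : 0 ≤ d := by positivity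
    have h1 : d ≤ 1 := min_le_left _ _
    have h2 : d * (8 * (‖L‖ + 1)) ≤ m := by
      rw [← le_div_iff₀ (by positivity)]; exact min_le_right _ _
    have h3 : ‖L‖ * d ^ 2 ≤ ‖L‖ * d :=
      mul_le_mul_of_nonneg_left (by nlinarith) (norm_nonneg _)
    have h4 : 0 ≤ ‖L‖ * d := by positivity
    nlinarith
  refine Set.PairwiseDisjoint.countable_of_isOpen (s := fun μ => Metric.ball (v μ) d) ?_
    (fun _ _ => Metric.isOpen_ball) (fun μ _ => ⟨v μ, Metric.mem_ball_self hd⟩)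
  intro μ hμ ν hν hne
  refine Metric.ball_disjoint_ball ?_
  rw [dist_eq_norm]
  by_contra! hlt
  have h1 := hsep μ hμ ν hν hne
  have h2 : ‖v μ - v ν‖ ^ 2 ≤ (2 * d) ^ 2 := by
    have := norm_nonneg (v μ - v ν)
    nlinarith
  nlinarith [mul_le_mul_of_nonneg_left h2 (norm_nonneg L)]

end SelfAdjointPencil

/-! ### Convolution operators on `L²` -/

/-- The Hilbert space `L²(ℝ; ℂ)`. -/
abbrev L2R : Type := Lp ℂ 2 (volume : Measure ℝ)

/-- Admissible convolution kernels: nonnegative, Borel, integrable and square integrable. -/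
structure IsConvKernel (h : ℝ → ℝ) : Prop where
  measurable : Measurable h
  nonneg : ∀ t, 0 ≤ h t
  integrable : Integrable h
  memLp : MemLp h 2

namespace IsConvKernel

variable {h : ℝ → ℝ}

theorem comp_neg (hh : IsConvKernel h) : IsConvKernel (fun t => h (-t)) where
  measurable := hh.measurable.comp measurable_neg
  nonneg _ := hh.nonneg _
  integrable := hh.integrable.comp_neg
  memLp := hh.memLp.comp_measurePreserving (Measure.measurePreserving_neg volume)

theorem memLp_sub (hh : IsConvKernel h) (x : ℝ) : MemLp (fun y => (h (x - y) : ℂ)) 2 :=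
  (hh.memLp.comp_measurePreserving (Measure.measurePreserving_sub_left volume x)).ofReal

/-- The function `y ↦ h (x - y)` as an element of `L²`. -/
noncomputable def slice (hh : IsConvKernel h) (x : ℝ) : L2R := (hh.memLp_sub x).toLp _

/-- Pointwise values of the convolution `h * f`, for `f ∈ L²`. -/
noncomputable def conv (hh : IsConvKernel h) (f : L2R) (x : ℝ) : ℂ := inner ℂ (hh.slice x) f

theorem conv_eq_integral (hh : IsConvKernel h) (f : L2R) (x : ℝ) :
    hh.conv f x = ∫ y, (h (x - y) : ℂ) * f y := by
  rw [conv, L2.inner_def]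
  refine integral_congr_ae ?_
  filter_upwards [(hh.memLp_sub x).coeFn_toLp] with y hy
  rw [slice, hy]
  simp [mul_comm]

theorem integrable_sub_mul (hh : IsConvKernel h) {f : ℝ → ℂ} (hf : MemLp f 2) (x : ℝ) :
    Integrable (fun y => (h (x - y) : ℂ) * f y) :=
  (hh.memLp_sub x).integrable_mul hf

theorem measurable_sub (hh : IsConvKernel h) : Measurable (fun p : ℝ × ℝ => h (p.1 - p.2)) :=
  hh.measurable.comp (measurable_fst.sub measurable_snd)

/-- Schur's test: convolution with an integrable kernel is bounded on `L²`. -/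
theorem lintegral_sq_le (hh : IsConvKernel h) {f : ℝ → ENNReal} (hf : Measurable f) :
    ∫⁻ x, (∫⁻ y, ‖h (x - y)‖ₑ * f y) ^ (2 : ℝ) ≤
      (∫⁻ t, ‖h t‖ₑ) ^ (2 : ℝ) * ∫⁻ y, f y ^ (2 : ℝ) := by
  set H := ∫⁻ t, ‖h t‖ₑ with hH
  have hm : Measurable (fun p : ℝ × ℝ => ‖h (p.1 - p.2)‖ₑ) := hh.measurable_sub.enorm
  have hmx : ∀ x, Measurable (fun y => ‖h (x - y)‖ₑ) := fun x =>
    hm.comp (measurable_const.prodMk measurable_id)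
  have hsq : ∀ a : ENNReal, (a ^ (1 / 2 : ℝ)) ^ (2 : ℝ) = a := fun a => by
    rw [← ENNReal.rpow_mul]; norm_num
  have hpt : ∀ x, (∫⁻ y, ‖h (x - y)‖ₑ * f y) ^ (2 : ℝ) ≤
      H * ∫⁻ y, ‖h (x - y)‖ₑ * f y ^ (2 : ℝ) := by
    intro x
    -- Cauchy-Schwarz for the splitting `h f = h^(1/2) (h^(1/2) f)`
    have hcs := ENNReal.lintegral_mul_le_Lp_mul_Lq volume (p := 2) (q := 2)
      Real.HolderConjugate.two_two
      (f := fun y => ‖h (x - y)‖ₑ ^ (1 / 2 : ℝ)) (g := fun y => ‖h (x - y)‖ₑ ^ (1 / 2 : ℝ) * f y)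
      ((hmx x).pow_const _).aemeasurable (((hmx x).pow_const _).mul hf).aemeasurable
    have e1 : ∀ y, ((fun y => ‖h (x - y)‖ₑ ^ (1 / 2 : ℝ)) *
        (fun y => ‖h (x - y)‖ₑ ^ (1 / 2 : ℝ) * f y)) y = ‖h (x - y)‖ₑ * f y := by
      intro y
      have := hsq ‖h (x - y)‖ₑ
      rw [ENNReal.rpow_two, pow_two] at this
      rw [Pi.mul_apply, ← mul_assoc, this]
    simp only [e1, hsq, ENNReal.mul_rpow_of_nonneg _ _ (zero_le_two : (0 : ℝ) ≤ 2)] at hcs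
    rw [lintegral_sub_left_eq_self (fun t => ‖h t‖ₑ) x] at hcs
    calc _ ≤ (H ^ (1 / 2 : ℝ) * (∫⁻ y, ‖h (x - y)‖ₑ * f y ^ (2 : ℝ)) ^ (1 / 2 : ℝ)) ^ (2 : ℝ) :=
          ENNReal.rpow_le_rpow hcs zero_le_two
      _ = _ := by rw [ENNReal.mul_rpow_of_nonneg _ _ zero_le_two, hsq, hsq]
  calc _ ≤ ∫⁻ x, H * ∫⁻ y, ‖h (x - y)‖ₑ * f y ^ (2 : ℝ) := lintegral_mono hpt
    _ = H * ∫⁻ x, ∫⁻ y, ‖h (x - y)‖ₑ * f y ^ (2 : ℝ) := by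
      refine lintegral_const_mul _ ?_
      exact Measurable.lintegral_prod_right'
        (f := fun p : ℝ × ℝ => ‖h (p.1 - p.2)‖ₑ * f p.2 ^ (2 : ℝ))
        (hm.mul ((hf.comp measurable_snd).pow_const _))
    _ = H * ∫⁻ y, ∫⁻ x, ‖h (x - y)‖ₑ * f y ^ (2 : ℝ) := by
      rw [lintegral_lintegral_swap]
      exact (hm.mul ((hf.comp measurable_snd).pow_const _)).aemeasurable
    _ = H * ∫⁻ y, H * f y ^ (2 : ℝ) := by
      congr 1
      refine lintegral_congr fun y => ?_
      have hmy : Measurable (fun x => ‖h (x - y)‖ₑ) :=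
        hm.comp (measurable_id.prodMk measurable_const)
      rw [lintegral_mul_const _ hmy, lintegral_sub_right_eq_self (fun t => ‖h t‖ₑ) y]
    _ = _ := by
      rw [lintegral_const_mul _ (hf.pow_const _), ← mul_assoc, ENNReal.rpow_two, pow_two]

theorem eLpNorm_lintegral_le (hh : IsConvKernel h) {f : ℝ → ENNReal} (hf : Measurable f) :
    eLpNorm (fun x => ∫⁻ y, ‖h (x - y)‖ₑ * f y) 2 volume ≤
      (∫⁻ t, ‖h t‖ₑ) * eLpNorm f 2 volume := by
  rw [eLpNorm_eq_lintegral_rpow_enorm_toReal two_ne_zero ENNReal.ofNat_ne_top,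
    eLpNorm_eq_lintegral_rpow_enorm_toReal two_ne_zero ENNReal.ofNat_ne_top]
  simp only [enorm_eq_self, ENNReal.toReal_ofNat]
  refine (ENNReal.rpow_le_rpow (hh.lintegral_sq_le hf) (by norm_num)).trans_eq ?_
  rw [ENNReal.mul_rpow_of_nonneg _ _ (by norm_num), ← ENNReal.rpow_mul]
  norm_num

theorem eLpNorm_conv_le (hh : IsConvKernel h) (f : L2R) :
    eLpNorm (hh.conv f) 2 volume ≤ (∫⁻ t, ‖h t‖ₑ) * eLpNorm f 2 volume := by
  have hf : Measurable (fun y => ‖(f : ℝ → ℂ) y‖ₑ) := (Lp.stronglyMeasurable f).measurable.enorm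
  refine le_trans ?_ ((hh.eLpNorm_lintegral_le hf).trans_eq ?_)
  · refine eLpNorm_mono_enorm fun x => ?_
    rw [hh.conv_eq_integral, enorm_eq_self]
    refine (enorm_integral_le_lintegral_enorm _).trans (lintegral_mono fun y => ?_)
    rw [enorm_mul]
    simp [← ofReal_norm]
  · simp only [eLpNorm_enorm]

theorem stronglyMeasurable_conv (hh : IsConvKernel h) (f : L2R) :
    StronglyMeasurable (hh.conv f) := by
  have : hh.conv f = fun x => ∫ y, (h (x - y) : ℂ) * f y := funext (hh.conv_eq_integral f)
  rw [this]
  refine StronglyMeasurable.integral_prod_right (f := fun x y => (h (x - y) : ℂ) * f y) ?_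
  refine Measurable.stronglyMeasurable ?_
  exact (Complex.measurable_ofReal.comp hh.measurable_sub).mul
    ((Lp.stronglyMeasurable f).measurable.comp measurable_snd)

theorem lintegral_enorm_ne_top (hh : IsConvKernel h) : ∫⁻ t, ‖h t‖ₑ ≠ ⊤ :=
  hh.integrable.hasFiniteIntegral.ne

theorem memLp_conv (hh : IsConvKernel h) (f : L2R) : MemLp (hh.conv f) 2 :=
  ⟨(hh.stronglyMeasurable_conv f).aestronglyMeasurable,
    (hh.eLpNorm_conv_le f).trans_lt (ENNReal.mul_lt_top hh.lintegral_enorm_ne_top.lt_top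
      (Lp.memLp f).2)⟩

/-- Convolution with `h` as a bounded operator on `L²`. -/
noncomputable def convOp (hh : IsConvKernel h) : L2R →L[ℂ] L2R :=
  LinearMap.mkContinuous
    { toFun := fun f => (hh.memLp_conv f).toLp _
      map_add' := fun f g => by
        rw [← MemLp.toLp_add]
        congr 1
        ext x
        simp [conv, inner_add_right]
      map_smul' := fun c f => by
        rw [RingHom.id_apply, ← MemLp.toLp_const_smul]
        congr 1
        ext x
        simp [conv, inner_smul_right] }
    (∫⁻ t, ‖h t‖ₑ).toReal (fun f => by
      change ‖(hh.memLp_conv f).toLp _‖ ≤ _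
      rw [Lp.norm_toLp, Lp.norm_def, ← ENNReal.toReal_mul]
      exact ENNReal.toReal_mono (ENNReal.mul_ne_top hh.lintegral_enorm_ne_top (Lp.memLp f).2.ne)
        (hh.eLpNorm_conv_le f))

theorem coeFn_convOp (hh : IsConvKernel h) (f : L2R) :
    (hh.convOp f : ℝ → ℂ) =ᵐ[volume] hh.conv f :=
  (hh.memLp_conv f).coeFn_toLp

/-- The adjoint of convolution with `h` is convolution with the reflected kernel. -/
theorem inner_convOp_comp_neg (hh : IsConvKernel h) (f g : L2R) :
    inner ℂ (hh.comp_neg.convOp f) g = inner ℂ f (hh.convOp g) := by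
  have hfm := (Lp.stronglyMeasurable f).measurable
  have hgm := (Lp.stronglyMeasurable g).measurable
  have hint : Integrable (Function.uncurry fun x y => (starRingEnd ℂ) (f x) *
      ((h (x - y) : ℂ) * g y)) ((volume : Measure ℝ).prod volume) := by
    have hmeas : Measurable (Function.uncurry fun x y => (starRingEnd ℂ) (f x) *
      ((h (x - y) : ℂ) * g y)) :=
      (Complex.continuous_conj.measurable.comp (hfm.comp measurable_fst)).mul
        ((Complex.measurable_ofReal.comp hh.measurable_sub).mul (hgm.comp measurable_snd))
    refine ⟨hmeas.aestronglyMeasurable, ?_⟩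
    rw [HasFiniteIntegral, lintegral_prod _ hmeas.enorm.aemeasurable]
    have e : ∀ x, ∫⁻ y, ‖Function.uncurry (fun x y => (starRingEnd ℂ) (f x) *
        ((h (x - y) : ℂ) * g y)) (x, y)‖ₑ = ‖f x‖ₑ * ∫⁻ y, ‖h (x - y)‖ₑ * ‖g y‖ₑ := by
      intro x
      rw [← lintegral_const_mul]
      · refine lintegral_congr fun y => ?_
        simp [Function.uncurry, ← ofReal_norm]
      · exact (hh.measurable_sub.enorm.comp (measurable_const.prodMk measurable_id)).mul
          hgm.enorm
    simp only [e]
    have hcs := ENNReal.lintegral_mul_le_Lp_mul_Lq volume (p := 2) (q := 2)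
      Real.HolderConjugate.two_two
      (f := fun x => ‖f x‖ₑ) (g := fun x => ∫⁻ y, ‖h (x - y)‖ₑ * ‖g y‖ₑ) hfm.enorm.aemeasurable
      (Measurable.lintegral_prod_right' (f := fun p : ℝ × ℝ => ‖h (p.1 - p.2)‖ₑ * ‖g p.2‖ₑ)
        (hh.measurable_sub.enorm.mul (hgm.comp measurable_snd).enorm)).aemeasurable
    refine hcs.trans_lt (ENNReal.mul_lt_top ?_ ?_)
    · refine ENNReal.rpow_lt_top_of_nonneg (by norm_num) (ne_of_lt ?_)
      simpa using (eLpNorm_lt_top_iff_lintegral_rpow_enorm_lt_top two_ne_zero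
        ENNReal.ofNat_ne_top).1 (Lp.memLp f).2
    · refine ENNReal.rpow_lt_top_of_nonneg (by norm_num) (ne_of_lt ?_)
      refine (hh.lintegral_sq_le hgm.enorm).trans_lt (ENNReal.mul_lt_top ?_ ?_)
      · exact ENNReal.rpow_lt_top_of_nonneg (by norm_num) hh.lintegral_enorm_ne_top
      · simpa using (eLpNorm_lt_top_iff_lintegral_rpow_enorm_lt_top two_ne_zero
          ENNReal.ofNat_ne_top).1 (Lp.memLp g).2
  have h1 : inner ℂ f (hh.convOp g) = ∫ x, ∫ y, (starRingEnd ℂ) (f x) * ((h (x - y) : ℂ) * g y) := by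
    rw [L2.inner_def]
    refine integral_congr_ae ?_
    filter_upwards [hh.coeFn_convOp g] with x hx
    rw [hx, hh.conv_eq_integral, integral_const_mul]
    simp [mul_comm]
  have h2 : inner ℂ (hh.comp_neg.convOp f) g =
      ∫ y, ∫ x, (starRingEnd ℂ) (f x) * ((h (x - y) : ℂ) * g y) := by
    rw [L2.inner_def]
    refine integral_congr_ae ?_
    filter_upwards [hh.comp_neg.coeFn_convOp f] with y hy
    rw [hy, hh.comp_neg.conv_eq_integral, RCLike.inner_apply, ← integral_conj, ← integral_const_mul]
    refine integral_congr_ae (Eventually.of_forall fun x => ?_)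
    simp
    ring
  rw [h1, h2, integral_integral_swap hint]

theorem adjoint_convOp (hh : IsConvKernel h) :
    ContinuousLinearMap.adjoint hh.convOp = hh.comp_neg.convOp := by
  symm
  rw [ContinuousLinearMap.eq_adjoint_iff]
  exact hh.inner_convOp_comp_neg

end IsConvKernel

/-! ### The exponential kernel -/

/-- The fundamental solution `t ↦ exp (-k t)` (`t ≥ 0`), `0` (`t < 0`), of `d/dt + k`. -/
noncomputable def expKernel (k t : ℝ) : ℝ := if 0 ≤ t then Real.exp (-(k * t)) else 0

theorem expKernel_eq_indicator (k : ℝ) :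
    expKernel k = (Set.Ici 0).indicator (fun t => Real.exp (-(k * t))) := by
  ext t; simp [expKernel, Set.indicator_apply]

theorem integrable_expKernel {k : ℝ} (hk : 0 < k) : Integrable (expKernel k) := by
  rw [expKernel_eq_indicator, integrable_indicator_iff measurableSet_Ici,
    integrableOn_Ici_iff_integrableOn_Ioi]
  simpa using integrableOn_exp_mul_Ioi (a := -k) (by linarith) 0

theorem isConvKernel_expKernel {k : ℝ} (hk : 0 < k) : IsConvKernel (expKernel k) where
  measurable := by
    rw [expKernel_eq_indicator]
    exact Measurable.indicator (by fun_prop) measurableSet_Ici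
  nonneg t := by unfold expKernel; split_ifs <;> positivity
  integrable := integrable_expKernel hk
  memLp := by
    rw [memLp_two_iff_integrable_sq (integrable_expKernel hk).aestronglyMeasurable]
    convert integrable_expKernel (k := 2 * k) (by linarith) using 2 with t
    unfold expKernel
    split_ifs
    · rw [← Real.exp_nat_mul]; congr 1; push_cast; ring
    · simp

/-- The slices of the exponential kernel move continuously in `L²`: for `y ≤ x` the slice at `x` is
`exp (-k (x - y))` times the slice at `y`, plus a function bounded by `1` on `(y, x]`. -/
theorem norm_slice_sub_le {k : ℝ} (hk : 0 < k) {x y : ℝ} (hxy : y ≤ x) :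
    ‖(isConvKernel_expKernel hk).slice x - (isConvKernel_expKernel hk).slice y‖ ≤
      k * (x - y) * (eLpNorm (expKernel k) 2 volume).toReal + √(x - y) := by
  set hh := isConvKernel_expKernel hk
  have hnorm : ‖hh.slice y‖ = (eLpNorm (expKernel k) 2 volume).toReal := by
    rw [IsConvKernel.slice, Lp.norm_toLp]
    congr 1
    rw [← eLpNorm_comp_measurePreserving hh.memLp.1
      (Measure.measurePreserving_sub_left volume y)]
    refine eLpNorm_congr_norm_ae (Eventually.of_forall fun t => ?_)
    simp
  set e : ℝ := Real.exp (-(k * (x - y))) with he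
  have he1 : e ≤ 1 := Real.exp_le_one_iff.2 (by nlinarith)
  have he2 : 1 - e ≤ k * (x - y) := by
    have := Real.add_one_le_exp (-(k * (x - y))); linarith
  set J : L2R := indicatorConstLp 2 (measurableSet_Ioc (a := y) (b := x)) (by simp) (1 : ℂ)
  have hJ : ‖J‖ = √(x - y) := by
    rw [norm_indicatorConstLp two_ne_zero ENNReal.ofNat_ne_top]
    simp [Real.sqrt_eq_rpow, measureReal_def, ENNReal.toReal_ofReal (sub_nonneg.2 hxy)]
  have h1 : ‖hh.slice x - (e : ℂ) • hh.slice y‖ ≤ ‖J‖ := by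
    refine Lp.norm_le_norm_of_ae_le ?_
    filter_upwards [Lp.coeFn_sub (hh.slice x) ((e : ℂ) • hh.slice y),
      Lp.coeFn_smul (e : ℂ) (hh.slice y), (hh.memLp_sub x).coeFn_toLp,
      (hh.memLp_sub y).coeFn_toLp,
      indicatorConstLp_coeFn (p := 2) (hs := measurableSet_Ioc (a := y) (b := x))
        (hμs := by simp) (c := (1 : ℂ))] with t ht1 ht2 ht3 ht4 ht5
    rw [ht1, Pi.sub_apply, ht2, Pi.smul_apply, IsConvKernel.slice, IsConvKernel.slice, ht3, ht4,
      ht5]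
    simp only [expKernel, sub_nonneg, Set.indicator_apply, Set.mem_Ioc]
    by_cases h1 : t ≤ y
    · have h2 : t ≤ x := h1.trans hxy
      simp only [h1, h2, if_true]
      rw [smul_eq_mul, ← Complex.ofReal_mul, he, ← Real.exp_add,
        show -(k * (x - y)) + -(k * (y - t)) = -(k * (x - t)) by ring]
      simp
    · by_cases h2 : t ≤ x
      · simp only [h1, h2, if_true, if_false]
        simp only [not_le] at h1
        simp only [h1, Complex.ofReal_zero, smul_zero, sub_zero, Complex.norm_real,
          Real.norm_eq_abs, Real.abs_exp, and_self, if_true, norm_one]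
        exact Real.exp_le_one_iff.2 (by nlinarith)
      · simp [h1, h2]
  calc ‖hh.slice x - hh.slice y‖
      = ‖(hh.slice x - (e : ℂ) • hh.slice y) + ((e - 1 : ℝ) : ℂ) • hh.slice y‖ := by
        congr 1; push_cast; module
    _ ≤ √(x - y) + (1 - e) * ‖hh.slice y‖ := by
        refine (norm_add_le _ _).trans (add_le_add (h1.trans_eq hJ) ?_)
        rw [norm_smul, Complex.norm_real, Real.norm_eq_abs, abs_of_nonpos (by linarith), neg_sub]
    _ ≤ _ := by
        rw [hnorm, add_comm]
        gcongr

theorem uniformContinuous_slice_expKernel {k : ℝ} (hk : 0 < k) :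
    UniformContinuous (isConvKernel_expKernel hk).slice := by
  set N := (eLpNorm (expKernel k) 2 volume).toReal
  have hlim : Tendsto (fun d : ℝ => k * d * N + √d) (𝓝 0) (𝓝 0) := by
    have : Continuous (fun d : ℝ => k * d * N + √d) := by fun_prop
    simpa using this.tendsto 0
  rw [Metric.uniformContinuous_iff]
  intro η hη
  obtain ⟨δ, hδ, h⟩ := Metric.tendsto_nhds_nhds.1 hlim η hη
  refine ⟨δ, hδ, ?_⟩
  intro x y hxy
  wlog hle : y ≤ x generalizing x y
  · rw [dist_comm]
    exact this (by rwa [dist_comm]) (le_of_not_ge hle)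
  rw [dist_eq_norm]
  refine (norm_slice_sub_le hk hle).trans_lt ?_
  have h1 := h (x := x - y) (by simpa [Real.dist_eq] using hxy)
  rw [Real.dist_eq, sub_zero] at h1
  exact lt_of_abs_lt h1

/-- Convolution with the exponential kernel, at the level of functions. -/
noncomputable def expConv (k : ℝ) (g : ℝ → ℂ) (x : ℝ) : ℂ := ∫ y, (expKernel k (x - y) : ℂ) * g y

theorem IsConvKernel.conv_ae_eq {h : ℝ → ℝ} (hh : IsConvKernel h) {f : L2R} {g : ℝ → ℂ}
    (hg : f =ᵐ[volume] g) (x : ℝ) : hh.conv f x = ∫ y, (h (x - y) : ℂ) * g y := by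
  rw [hh.conv_eq_integral]
  refine integral_congr_ae ?_
  filter_upwards [hg] with y hy
  rw [hy]

theorem continuous_expConv {k : ℝ} (hk : 0 < k) {g : ℝ → ℂ} (hg : MemLp g 2) :
    Continuous (expConv k g) := by
  have : expConv k g = fun x => inner ℂ ((isConvKernel_expKernel hk).slice x) (hg.toLp g) :=
    funext fun x => ((isConvKernel_expKernel hk).conv_ae_eq hg.coeFn_toLp x).symm
  rw [this]
  exact (uniformContinuous_slice_expKernel hk).continuous.inner continuous_const

/-- `expConv k g` solves `u' + k u = g`. -/
theorem hasDerivAt_expConv {k : ℝ} (hk : 0 < k) {g : ℝ → ℂ} (hg : MemLp g 2) (hgc : Continuous g)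
    (x : ℝ) : HasDerivAt (expConv k g) (g x - k * expConv k g x) x := by
  set G : ℝ → ℂ := fun y => (Real.exp (k * y) : ℂ) * g y with hG
  have hGc : Continuous G := by fun_prop
  have hform : ∀ x y, (expKernel k (x - y) : ℂ) * g y =
      (Real.exp (-(k * x)) : ℂ) * (Set.Iic x).indicator G y := by
    intro x y
    simp only [expKernel, Set.indicator_apply, Set.mem_Iic, sub_nonneg, hG]
    split_ifs with h
    · rw [← mul_assoc, ← Complex.ofReal_mul, ← Real.exp_add]
      congr 3; ring
    · simp
  have hGi : ∀ x, IntegrableOn G (Set.Iic x) := by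
    intro x
    have h1 := (isConvKernel_expKernel hk).integrable_sub_mul hg x
    simp only [hform] at h1
    rw [← integrable_indicator_iff measurableSet_Iic]
    have h2 := h1.const_mul (Real.exp (k * x) : ℂ)
    simp only [← mul_assoc, ← Complex.ofReal_mul, ← Real.exp_add] at h2
    simpa using h2
  have heq : ∀ x, expConv k g x = (Real.exp (-(k * x)) : ℂ) *
      ((∫ y in Set.Iic 0, G y) + ∫ y in (0 : ℝ)..x, G y) := by
    intro x
    rw [intervalIntegral.integral_Iic_sub_Iic (hGi 0) (hGi x) |>.symm, add_sub_cancel,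
      ← integral_indicator measurableSet_Iic, expConv, ← integral_const_mul]
    exact integral_congr_ae (Eventually.of_forall (hform x))
  have hd1 : HasDerivAt (fun x => (∫ y in Set.Iic 0, G y) + ∫ y in (0 : ℝ)..x, G y) (G x) x :=
    (intervalIntegral.integral_hasDerivAt_right (hGc.intervalIntegrable _ _)
      hGc.stronglyMeasurable.stronglyMeasurableAtFilter hGc.continuousAt).const_add _
  have hd2 : HasDerivAt (fun x : ℝ => (Real.exp (-(k * x)) : ℂ))
      ((Real.exp (-(k * x)) * -k : ℝ) : ℂ) x := by
    have h := ((hasDerivAt_id x).const_mul k).neg.exp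
    simp only [id, mul_one] at h
    exact h.ofReal_comp
  have := hd2.mul hd1
  refine (this.congr_of_eventuallyEq (Eventually.of_forall heq)).congr_deriv ?_
  rw [heq x]
  have h3 : (Real.exp (-(k * x)) : ℂ) * G x = g x := by
    rw [hG, ← mul_assoc, ← Complex.ofReal_mul, ← Real.exp_add]; simp
  rw [h3]
  push_cast
  ring

/-- The reflected kernel, which gives `S†`, is the exponential kernel conjugated by `x ↦ -x`. -/
theorem integral_expKernel_reflect (k : ℝ) (g : ℝ → ℂ) (x : ℝ) :
    ∫ y, (expKernel k (-(x - y)) : ℂ) * g y = expConv k (fun y => g (-y)) (-x) := by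
  rw [expConv, ← integral_neg_eq_self]
  refine integral_congr_ae (Eventually.of_forall fun y => ?_)
  simp only
  congr 3
  ring

theorem MeasureTheory.MemLp.comp_neg {g : ℝ → ℂ} (hg : MemLp g 2) : MemLp (fun y => g (-y)) 2 :=
  hg.comp_measurePreserving (Measure.measurePreserving_neg volume)

/-! ### Multiplication operators -/

theorem memLp_mul_boundedContinuous (a : ℝ →ᵇ ℂ) {f : ℝ → ℂ} (hf : MemLp f 2) :
    MemLp (fun x => a x * f x) 2 :=
  MemLp.of_le_mul (c := ‖a‖) hf (a.continuous.aestronglyMeasurable.mul hf.1)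
    (Eventually.of_forall fun x => by
      rw [norm_mul]; exact mul_le_mul_of_nonneg_right (a.norm_coe_le_norm x) (norm_nonneg _))

/-- Multiplication by bounded continuous functions on `L²`, as a bounded bilinear map. -/
noncomputable def mulOp : (ℝ →ᵇ ℂ) →L[ℂ] L2R →L[ℂ] L2R :=
  LinearMap.mkContinuous₂
    (LinearMap.mk₂ ℂ (fun a f => (memLp_mul_boundedContinuous a (Lp.memLp f)).toLp _)
      (fun a b f => by
        rw [← MemLp.toLp_add]
        congr 1
        ext x
        simp [add_mul])
      (fun c a f => by
        rw [← MemLp.toLp_const_smul]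
        congr 1
        ext x
        simp [mul_assoc])
      (fun a f g => by
        rw [← MemLp.toLp_add, MemLp.toLp_eq_toLp_iff]
        filter_upwards [Lp.coeFn_add f g] with x hx
        change a x * (f + g : L2R) x = a x * f x + a x * g x
        rw [hx, Pi.add_apply, mul_add])
      (fun c a f => by
        rw [← MemLp.toLp_const_smul, MemLp.toLp_eq_toLp_iff]
        filter_upwards [Lp.coeFn_smul c f] with x hx
        simp only [hx, Pi.smul_apply, smul_eq_mul]
        ring)) 1
    (fun a f => by
      rw [one_mul]
      refine Lp.norm_le_mul_norm_of_ae_le_mul ?_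
      change ∀ᵐ x, ‖(memLp_mul_boundedContinuous a (Lp.memLp f)).toLp _ x‖ ≤ _
      filter_upwards [(memLp_mul_boundedContinuous a (Lp.memLp f)).coeFn_toLp] with x hx
      rw [hx, norm_mul]
      exact mul_le_mul_of_nonneg_right (a.norm_coe_le_norm x) (norm_nonneg _))

theorem coeFn_mulOp (a : ℝ →ᵇ ℂ) (f : L2R) : mulOp a f =ᵐ[volume] fun x => a x * f x :=
  (memLp_mul_boundedContinuous a (Lp.memLp f)).coeFn_toLp

theorem norm_mulOp_le (a : ℝ →ᵇ ℂ) : ‖mulOp a‖ ≤ ‖a‖ := by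
  refine ContinuousLinearMap.opNorm_le_bound _ (norm_nonneg _) fun f => ?_
  refine Lp.norm_le_mul_norm_of_ae_le_mul ?_
  filter_upwards [coeFn_mulOp a f] with x hx
  rw [hx, norm_mul]
  exact mul_le_mul_of_nonneg_right (a.norm_coe_le_norm x) (norm_nonneg _)

/-- Multiplication by a real function that is bounded below by `m` is bounded below by `m`. -/
theorem re_inner_mulOp_ge {a : ℝ →ᵇ ℂ} {α : ℝ → ℝ} (ha : ∀ x, a x = α x) {m : ℝ}
    (hm : ∀ x, m ≤ α x) (f : L2R) : m * ‖f‖ ^ 2 ≤ RCLike.re (inner ℂ (mulOp a f) f) := by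
  have h1 : ‖f‖ ^ 2 = RCLike.re (inner ℂ f f) := (inner_self_eq_norm_sq f).symm
  rw [h1, L2.inner_def, L2.inner_def, ← integral_re (L2.integrable_inner f f),
    ← integral_re (L2.integrable_inner (mulOp a f) f), ← integral_const_mul]
  refine integral_mono_ae ((L2.integrable_inner f f).re.const_mul m)
    (L2.integrable_inner (mulOp a f) f).re ?_
  filter_upwards [coeFn_mulOp a f] with x hx
  rw [hx, ha]
  have h2 : RCLike.re (inner ℂ (f x) (f x)) = ‖f x‖ ^ 2 := inner_self_eq_norm_sq (𝕜 := ℂ) (f x)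
  rw [← smul_eq_mul (α x : ℂ), inner_smul_left, Complex.conj_ofReal]
  have h3 : RCLike.re ((α x : ℂ) * inner ℂ (f x) (f x)) =
      α x * RCLike.re (inner ℂ (f x) (f x)) := by simp
  rw [h3, h2]
  exact mul_le_mul_of_nonneg_right (hm x) (by positivity)

theorem mulOp_isPositive {a : ℝ →ᵇ ℂ} {α : ℝ → ℝ} (ha : ∀ x, a x = α x)
    (h0 : ∀ x, 0 ≤ α x) : (mulOp a).IsPositive := by
  rw [ContinuousLinearMap.isPositive_def]
  refine ⟨fun f g => ?_, fun f => ?_⟩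
  · simp only [ContinuousLinearMap.coe_coe]
    rw [L2.inner_def, L2.inner_def]
    refine integral_congr_ae ?_
    filter_upwards [coeFn_mulOp a f, coeFn_mulOp a g] with x hx hy
    rw [hx, hy, ha, ← smul_eq_mul, ← smul_eq_mul, inner_smul_left, inner_smul_right,
      Complex.conj_ofReal]
  · simpa [ContinuousLinearMap.reApplyInnerSelf] using re_inner_mulOp_ge ha h0 f

/-! ### Compactness -/

theorem isCompactOperator_of_forall_norm_sub_le {E : Type*} [NormedAddCommGroup E]
    [NormedSpace ℂ E] [CompleteSpace E] {T : E →L[ℂ] E}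
    (h : ∀ η > 0, ∃ T' : E →L[ℂ] E, IsCompactOperator T' ∧ ‖T - T'‖ ≤ η) :
    IsCompactOperator T := by
  have hcl : IsClosed {f : E →L[ℂ] E | IsCompactOperator f} := isClosed_setOfPred_isCompactOperator
  have : T ∈ closure {f : E →L[ℂ] E | IsCompactOperator f} := by
    rw [Metric.mem_closure_iff]
    intro η hη
    obtain ⟨T', hT', hle⟩ := h (η / 2) (by positivity)
    exact ⟨T', hT', by rw [dist_eq_norm]; linarith⟩
  rwa [hcl.closure_eq] at this

theorem isCompactOperator_smulRight {E : Type*} [NormedAddCommGroup E] [NormedSpace ℂ E]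
    (l : E →L[ℂ] ℂ) (e : E) : IsCompactOperator (l.smulRight e) := by
  have h : IsCompactOperator (ContinuousLinearMap.toSpanSingleton ℂ e) :=
    isCompactOperator_of_locallyCompactSpace_rng (ContinuousLinearMap.toSpanSingleton ℂ e)
  exact h.comp_clm l

/-- Multiplication by a compactly supported function after convolution is the norm limit of the
finite-rank operators that sample the convolution on a grid. -/
theorem isCompactOperator_mulOp_convOp_of_hasCompactSupport {h : ℝ → ℝ} (hh : IsConvKernel h)
    (huc : UniformContinuous hh.slice) {a : ℝ →ᵇ ℂ} (ha : HasCompactSupport a) :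
    IsCompactOperator (mulOp a ∘L hh.convOp) := by
  have ha2 : MemLp a 2 := a.continuous.memLp_of_hasCompactSupport ha
  refine isCompactOperator_of_forall_norm_sub_le fun η hη => ?_
  set A := ‖ha2.toLp a‖ with hA
  have hA0 : 0 ≤ A := norm_nonneg _
  obtain ⟨d, hd, hdist⟩ := Metric.uniformContinuous_iff.1 huc (η / (A + 1)) (by positivity)
  obtain ⟨R, hR⟩ := ha.isBounded.exists_norm_le
  set δ := d / 2 with hδ
  have hδ0 : 0 < δ := by positivity
  set s : Finset ℤ := Finset.Icc ⌊-R / δ⌋ ⌊R / δ⌋ with hs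
  have hcell : ∀ j : ℤ, MeasurableSet {x : ℝ | ⌊x / δ⌋ = j} := fun j =>
    (measurableSet_singleton j).preimage (Int.measurable_floor.comp (measurable_id.div_const δ))
  have hej : ∀ j : ℤ, MemLp ({x : ℝ | ⌊x / δ⌋ = j}.indicator a) 2 := fun j =>
    ha2.indicator (hcell j)
  refine ⟨∑ j ∈ s, (innerSL ℂ (hh.slice (j * δ))).smulRight ((hej j).toLp _), ?_, ?_⟩
  · have : ∑ j ∈ s, (innerSL ℂ (hh.slice (j * δ))).smulRight ((hej j).toLp _) ∈
        compactOperator (RingHom.id ℂ) L2R L2R :=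
      Submodule.sum_mem _ fun j _ => isCompactOperator_smulRight _ _
    exact this
  · refine ContinuousLinearMap.opNorm_le_bound _ hη.le fun f => ?_
    have hle : ‖(mulOp a ∘L hh.convOp - ∑ j ∈ s, (innerSL ℂ (hh.slice (j * δ))).smulRight
        ((hej j).toLp _)) f‖ ≤ (η / (A + 1) * ‖f‖) * ‖ha2.toLp a‖ := by
      refine Lp.norm_le_mul_norm_of_ae_le_mul ?_
      have hsum : (mulOp a ∘L hh.convOp - ∑ j ∈ s, (innerSL ℂ (hh.slice (j * δ))).smulRight
        ((hej j).toLp _)) f = mulOp a (hh.convOp f) -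
          ∑ j ∈ s, hh.conv f (j * δ) • (hej j).toLp _ := by
        simp [IsConvKernel.conv]
      rw [hsum]
      have hall : ∀ᵐ x, ∀ j : ℤ, (hej j).toLp _ x = {x : ℝ | ⌊x / δ⌋ = j}.indicator a x :=
        ae_all_iff.2 fun j => (hej j).coeFn_toLp
      have hall2 : ∀ᵐ x, ∀ j : ℤ, (hh.conv f (j * δ) • (hej j).toLp _ : L2R) x =
          hh.conv f (j * δ) * (hej j).toLp _ x :=
        ae_all_iff.2 fun j => Lp.coeFn_smul _ _
      filter_upwards [Lp.coeFn_sub (mulOp a (hh.convOp f))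
          (∑ j ∈ s, hh.conv f (j * δ) • (hej j).toLp _), coeFn_mulOp a (hh.convOp f),
          hh.coeFn_convOp f, hall, hall2, ha2.coeFn_toLp,
          Lp.coeFn_fun_finsetSum s (fun j => hh.conv f (j * δ) • (hej j).toLp _)]
        with x h1 h2 h3 h4 h5 h6 h7
      rw [h1, Pi.sub_apply, h2, h3, h6, h7]
      simp only [h5, h4, Set.indicator_apply, Set.mem_ofPred_eq, mul_ite, mul_zero]
      rw [Finset.sum_ite_eq]
      by_cases hx : a x = 0
      · simp [hx]
      have hxR : ‖x‖ ≤ R := hR x (subset_tsupport _ hx)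
      rw [Real.norm_eq_abs, abs_le] at hxR
      have hmem : ⌊x / δ⌋ ∈ s := by
        rw [hs, Finset.mem_Icc]
        exact ⟨Int.floor_le_floor (by gcongr; exact hxR.1),
          Int.floor_le_floor (by gcongr; exact hxR.2)⟩
      rw [if_pos hmem]
      have hgrid : dist x (⌊x / δ⌋ * δ) < d := by
        have e1 := Int.floor_le (x / δ)
        have e2 := Int.lt_floor_add_one (x / δ)
        rw [le_div_iff₀ hδ0] at e1
        rw [div_lt_iff₀ hδ0] at e2
        rw [Real.dist_eq, abs_of_nonneg (by linarith)]
        nlinarith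
      have hval : ‖hh.conv f x - hh.conv f (⌊x / δ⌋ * δ)‖ ≤ η / (A + 1) * ‖f‖ := by
        rw [IsConvKernel.conv, IsConvKernel.conv, ← inner_sub_left]
        refine (norm_inner_le_norm _ _).trans (mul_le_mul_of_nonneg_right ?_ (norm_nonneg _))
        rw [← dist_eq_norm]
        exact (hdist hgrid).le
      calc _ = ‖hh.conv f x - hh.conv f (⌊x / δ⌋ * δ)‖ * ‖a x‖ := by rw [← norm_mul]; ring_nf
        _ ≤ _ := mul_le_mul_of_nonneg_right hval (norm_nonneg _)
    refine hle.trans ?_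
    rw [← hA]
    have : η / (A + 1) * A ≤ η := by
      rw [div_mul_eq_mul_div, div_le_iff₀ (by positivity)]; nlinarith
    nlinarith [norm_nonneg f]

/-- Soft thresholding: a continuous function vanishing at infinity is a uniform limit of compactly
supported ones. -/
theorem exists_hasCompactSupport_norm_sub_le {a : ℝ →ᵇ ℂ} (ha : Tendsto a (cocompact ℝ) (𝓝 0))
    {η : ℝ} (hη : 0 < η) : ∃ b : ℝ →ᵇ ℂ, HasCompactSupport b ∧ ‖a - b‖ ≤ η := by
  set t : ℝ → ℝ := fun x => max 0 (‖a x‖ - η) / max ‖a x‖ η with ht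
  have hpos : ∀ x, 0 < max ‖a x‖ η := fun x => lt_max_of_lt_right hη
  have htc : Continuous t := by
    refine Continuous.div (by fun_prop) (by fun_prop) fun x => (hpos x).ne'
  have hdiff : ∀ x, ‖a x - t x * a x‖ ≤ η := by
    intro x
    have e : a x - t x * a x = ((1 - t x : ℝ) : ℂ) * a x := by push_cast; ring
    rw [e, norm_mul, Complex.norm_real, Real.norm_eq_abs]
    rcases le_total ‖a x‖ η with h | h
    · have : t x = 0 := by simp [ht, max_eq_left (sub_nonpos.2 h)]
      simpa [this] using h
    · have h0 : 0 < ‖a x‖ := hη.trans_le h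
      have : 1 - t x = η / ‖a x‖ := by
        simp only [ht]
        rw [max_eq_right (sub_nonneg.2 h), max_eq_left h]
        field_simp
        ring
      rw [this, abs_of_nonneg (by positivity)]
      field_simp
      exact le_rfl
  let b : ℝ →ᵇ ℂ := BoundedContinuousFunction.ofNormedAddCommGroup (fun x => t x * a x)
    (by fun_prop) (‖a‖ + η) fun x => by
      have h1 := norm_sub_norm_le (t x * a x : ℂ) (a x)
      rw [norm_sub_rev] at h1
      linarith [hdiff x, a.norm_coe_le_norm x]
  refine ⟨b, ?_, ?_⟩
  · have hev : ∀ᶠ x in cocompact ℝ, ‖a x‖ < η := by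
      have := ha.norm
      rw [norm_zero] at this
      exact this.eventually_lt_const hη
    obtain ⟨K, hK, hKs⟩ := mem_cocompact.1 hev
    refine HasCompactSupport.intro hK fun x hx => ?_
    have h1 : ‖a x‖ < η := hKs hx
    change (t x : ℂ) * a x = 0
    simp [ht, max_eq_left (sub_nonpos.2 h1.le)]
  · rw [BoundedContinuousFunction.norm_le hη.le]
    exact hdiff

/-- Multiplication by a function vanishing at infinity, after convolution, is compact. -/
theorem isCompactOperator_mulOp_convOp {h : ℝ → ℝ} (hh : IsConvKernel h)
    (huc : UniformContinuous hh.slice) {a : ℝ →ᵇ ℂ} (ha : Tendsto a (cocompact ℝ) (𝓝 0)) :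
    IsCompactOperator (mulOp a ∘L hh.convOp) := by
  refine isCompactOperator_of_forall_norm_sub_le fun η hη => ?_
  obtain ⟨b, hb, hab⟩ := exists_hasCompactSupport_norm_sub_le ha
    (η := η / (‖hh.convOp‖ + 1)) (by positivity)
  refine ⟨_, isCompactOperator_mulOp_convOp_of_hasCompactSupport hh huc hb, ?_⟩
  rw [← ContinuousLinearMap.sub_comp, ← map_sub]
  refine (ContinuousLinearMap.opNorm_comp_le _ _).trans ?_
  calc _ ≤ η / (‖hh.convOp‖ + 1) * (‖hh.convOp‖ + 1) := by
        gcongr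
        · exact (norm_mulOp_le _).trans hab
        · linarith
    _ = η := by field_simp

/-! ### The energy form -/

open ContinuousLinearMap in
/-- The operator on `L²` of the quadratic form `f ↦ ∫ ρ (|u'|² + k² |u|²)`, where `u = expConv k f`,
that is, `u' + k u = f`. -/
noncomputable def energyOp {k : ℝ} (hk : 0 < k) (ρ : ℝ →ᵇ ℂ) : L2R →L[ℂ] L2R :=
  adjoint (1 - (k : ℂ) • (isConvKernel_expKernel hk).convOp) ∘L mulOp ρ ∘L
      (1 - (k : ℂ) • (isConvKernel_expKernel hk).convOp) +
    ((k ^ 2 : ℝ) : ℂ) • (adjoint (isConvKernel_expKernel hk).convOp ∘L mulOp ρ ∘L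
      (isConvKernel_expKernel hk).convOp)

open ContinuousLinearMap in
/-- The operator on `L²` of the form `f ↦ ∫ q |u|²`, where `u = expConv k f`. -/
noncomputable def potentialOp {k : ℝ} (hk : 0 < k) (q : ℝ →ᵇ ℂ) : L2R →L[ℂ] L2R :=
  adjoint (isConvKernel_expKernel hk).convOp ∘L mulOp q ∘L (isConvKernel_expKernel hk).convOp

section

variable {k : ℝ} (hk : 0 < k) {a : ℝ →ᵇ ℂ} {α : ℝ → ℝ}

theorem potentialOp_isPositive (ha : ∀ x, a x = α x) (h0 : ∀ x, 0 ≤ α x) :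
    (potentialOp hk a).IsPositive :=
  (mulOp_isPositive ha h0).adjoint_conj _

theorem energyOp_isPositive (ha : ∀ x, a x = α x) (h0 : ∀ x, 0 ≤ α x) :
    (energyOp hk a).IsPositive := by
  refine ((mulOp_isPositive ha h0).adjoint_conj _).add
    (((mulOp_isPositive ha h0).adjoint_conj _).smul_of_nonneg ?_)
  exact Complex.zero_le_real.2 (by positivity)

theorem energyOp_coercive (ha : ∀ x, a x = α x) {m : ℝ} (hm : 0 ≤ m) (h0 : ∀ x, m ≤ α x)
    (f : L2R) : m / 2 * ‖f‖ ^ 2 ≤ RCLike.re (inner ℂ (energyOp hk a f) f) := by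
  set S := (isConvKernel_expKernel hk).convOp with hS
  set Df := (1 - (k : ℂ) • S) f with hDf
  have h1 := re_inner_mulOp_ge ha h0 Df
  have h2 := re_inner_mulOp_ge ha h0 (S f)
  have h3 : inner ℂ (energyOp hk a f) f = inner ℂ (mulOp a Df) Df +
      ((k ^ 2 : ℝ) : ℂ) * inner ℂ (mulOp a (S f)) (S f) := by
    rw [energyOp, add_apply, inner_add_left, smul_apply,
      inner_smul_left, Complex.conj_ofReal, ContinuousLinearMap.comp_apply,
      ContinuousLinearMap.comp_apply, ContinuousLinearMap.comp_apply,
      ContinuousLinearMap.comp_apply, ContinuousLinearMap.adjoint_inner_left,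
      ContinuousLinearMap.adjoint_inner_left]
  have h4 : RCLike.re (inner ℂ (energyOp hk a f) f) = RCLike.re (inner ℂ (mulOp a Df) Df) +
      k ^ 2 * RCLike.re (inner ℂ (mulOp a (S f)) (S f)) := by
    rw [h3, map_add]
    congr 1
    exact Complex.re_ofReal_mul _ _
  have h5 : ‖f‖ ≤ ‖Df‖ + k * ‖S f‖ := by
    have : f = Df + (k : ℂ) • S f := by
      rw [hDf, sub_apply, smul_apply]; exact (sub_add_cancel f _).symm
    calc ‖f‖ = ‖Df + (k : ℂ) • S f‖ := by rw [← this]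
      _ ≤ _ := (norm_add_le _ _).trans_eq (by
        rw [norm_smul, Complex.norm_real, Real.norm_eq_abs, abs_of_pos hk])
  have h6 : ‖f‖ ^ 2 ≤ 2 * (‖Df‖ ^ 2 + k ^ 2 * ‖S f‖ ^ 2) := by
    have := norm_nonneg f
    nlinarith [sq_nonneg (‖Df‖ - k * ‖S f‖)]
  rw [h4]
  nlinarith [mul_le_mul_of_nonneg_left h6 hm, mul_le_mul_of_nonneg_left h2 (sq_nonneg k)]

theorem energyOp_isUnit (ha : ∀ x, a x = α x) {m : ℝ} (hm : 0 < m) (h0 : ∀ x, m ≤ α x) :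
    IsUnit (energyOp hk a) := by
  refine ContinuousLinearMap.isUnit_of_forall_le_norm_inner_map _
    (c := ⟨m / 2, by positivity⟩) (by exact_mod_cast (by positivity : 0 < m / 2)) fun f => ?_
  refine le_trans ?_ (RCLike.re_le_norm _)
  refine le_trans (le_of_eq ?_) (energyOp_coercive hk ha hm.le h0 f)
  change ‖f‖ ^ 2 * (m / 2) = _
  ring

theorem potentialOp_isCompactOperator (ha : Tendsto a (cocompact ℝ) (𝓝 0)) :
    IsCompactOperator (potentialOp hk a) :=
  (isCompactOperator_mulOp_convOp (isConvKernel_expKernel hk)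
    (uniformContinuous_slice_expKernel hk) ha).clm_comp
      (ContinuousLinearMap.adjoint (isConvKernel_expKernel hk).convOp)

/-- Convolving a tent function `g` would otherwise give `u = 0`, against `u' + k u = g`. -/
theorem convOp_expKernel_ne_zero : (isConvKernel_expKernel hk).convOp ≠ 0 := by
  intro h
  set g : ℝ → ℂ := fun x => ((max 0 (1 - |x|) : ℝ) : ℂ) with hg
  have hgc : Continuous g := by fun_prop
  have hgs : HasCompactSupport g := by
    refine HasCompactSupport.intro (isCompact_Icc (a := (-1 : ℝ)) (b := 1)) fun x hx => ?_
    have : 1 < |x| := by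
      by_contra! hle
      exact hx (abs_le.1 hle)
    simp [hg, max_eq_left (by linarith : 1 - |x| ≤ 0)]
  have hg2 : MemLp g 2 := hgc.memLp_of_hasCompactSupport hgs
  have hae : expConv k g =ᵐ[volume] fun _ => (0 : ℂ) := by
    have h1 := (isConvKernel_expKernel hk).coeFn_convOp (hg2.toLp g)
    rw [h] at h1
    filter_upwards [h1, Lp.coeFn_zero ℂ 2 (volume : Measure ℝ)] with x hx hx0
    have h2 := (isConvKernel_expKernel hk).conv_ae_eq hg2.coeFn_toLp x
    rw [expConv, ← h2, ← hx]
    simp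
  have heq : expConv k g = fun _ => 0 :=
    ((continuous_expConv hk hg2).ae_eq_iff_eq volume continuous_const).1 hae
  have h0 := hasDerivAt_expConv hk hg2 hgc 0
  rw [heq] at h0
  have := h0.unique (hasDerivAt_const (0 : ℝ) (0 : ℂ))
  simp [hg] at this

theorem potentialOp_ne_zero (ha : ∀ x, a x = α x) (h0 : ∀ x, 0 < α x) :
    potentialOp hk a ≠ 0 := by
  intro h
  apply convOp_expKernel_ne_zero hk
  ext1 f
  set u := (isConvKernel_expKernel hk).convOp f with hu
  have h1 : inner ℂ (mulOp a u) u = 0 := by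
    have : inner ℂ (potentialOp hk a f) f = 0 := by rw [h]; simp
    rwa [potentialOp, ContinuousLinearMap.comp_apply, ContinuousLinearMap.comp_apply,
      ContinuousLinearMap.adjoint_inner_left] at this
  have hpt : (fun x => (inner ℂ (mulOp a u x) (u x) : ℂ)) =ᵐ[volume]
      fun x => ((α x * ‖u x‖ ^ 2 : ℝ) : ℂ) := by
    filter_upwards [coeFn_mulOp a u] with x hx
    rw [hx, ha, ← smul_eq_mul, inner_smul_left, Complex.conj_ofReal, inner_self_eq_norm_sq_to_K]
    push_cast
    rfl
  have hint : Integrable (fun x => α x * ‖u x‖ ^ 2) := by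
    have := ((L2.integrable_inner (𝕜 := ℂ) (mulOp a u) u).congr hpt).re
    exact this.congr (Eventually.of_forall fun x => Complex.ofReal_re _)
  rw [L2.inner_def, integral_congr_ae hpt, integral_complex_ofReal, Complex.ofReal_eq_zero,
    integral_eq_zero_iff_of_nonneg (fun x => by have := (h0 x).le; positivity) hint] at h1
  rw [zero_apply, Lp.eq_zero_iff_ae_eq_zero]
  filter_upwards [h1] with x hx
  have hx' : α x * ‖u x‖ ^ 2 = 0 := hx
  simpa [(h0 x).ne'] using hx'

end

/-! ### The resolvent of the velocity profile -/

/-- The bounded continuous function `1 / (V - c)`, for `Im c > 0` (and `0` otherwise). -/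
noncomputable def invSub {V : ℝ → ℝ} (hV : Continuous V) (c : ℂ) : ℝ →ᵇ ℂ :=
  open Classical in
  if h : 0 < c.im then
    BoundedContinuousFunction.ofNormedAddCommGroup (fun y => ((V y : ℂ) - c)⁻¹)
      (Continuous.inv₀ (by fun_prop) fun y hy => by
        have := congrArg Complex.im hy
        simp at this
        exact h.ne' this)
      (c.im⁻¹) (fun y => by
        rw [norm_inv]
        refine inv_anti₀ h ?_
        have := Complex.abs_im_le_norm ((V y : ℂ) - c)
        simp only [Complex.sub_im, Complex.ofReal_im, zero_sub, abs_neg] at this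
        exact (le_abs_self _).trans this)
  else 0

section

variable {V : ℝ → ℝ} (hV : Continuous V)

theorem ofReal_sub_ne_zero {c : ℂ} (hc : 0 < c.im) (x : ℝ) : (x : ℂ) - c ≠ 0 := fun h => by
  have := congrArg Complex.im h
  simp at this
  exact hc.ne' this

theorem invSub_apply {c : ℂ} (hc : 0 < c.im) (y : ℝ) : invSub hV c y = ((V y : ℂ) - c)⁻¹ := by
  simp [invSub, hc]

theorem norm_invSub_le {c : ℂ} (hc : 0 < c.im) : ‖invSub hV c‖ ≤ c.im⁻¹ := by
  rw [invSub, dif_pos hc]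
  exact BoundedContinuousFunction.norm_ofNormedAddCommGroup_le _ (inv_nonneg.2 hc.le) _

/-- The resolvent identity. -/
theorem invSub_sub_invSub {c d : ℂ} (hc : 0 < c.im) (hd : 0 < d.im) :
    invSub hV d - invSub hV c = (d - c) • (invSub hV d * invSub hV c) := by
  ext y
  simp only [BoundedContinuousFunction.coe_sub, Pi.sub_apply, invSub_apply hV hc,
    invSub_apply hV hd, BoundedContinuousFunction.coe_smul, BoundedContinuousFunction.coe_mul,
    Pi.mul_apply, smul_eq_mul]
  have h1 := ofReal_sub_ne_zero hc (V y)
  have h2 := ofReal_sub_ne_zero hd (V y)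
  field_simp
  ring

theorem hasDerivAt_invSub {c : ℂ} (hc : 0 < c.im) :
    HasDerivAt (invSub hV) (invSub hV c * invSub hV c) c := by
  have hopen : IsOpen {d : ℂ | 0 < d.im} := isOpen_lt continuous_const Complex.continuous_im
  have hev : ∀ᶠ d in 𝓝 c, 0 < d.im := hopen.mem_nhds hc
  have hev2 : ∀ᶠ d in 𝓝 c, c.im / 2 < d.im :=
    (isOpen_lt continuous_const Complex.continuous_im).mem_nhds (by simp; linarith)
  have hcont : Tendsto (invSub hV) (𝓝 c) (𝓝 (invSub hV c)) := by
    rw [tendsto_iff_norm_sub_tendsto_zero]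
    have hb : Tendsto (fun d : ℂ => ‖d - c‖ * ((c.im / 2)⁻¹ * c.im⁻¹)) (𝓝 c) (𝓝 0) := by
      have : Continuous (fun d : ℂ => ‖d - c‖ * ((c.im / 2)⁻¹ * c.im⁻¹)) := by fun_prop
      simpa using this.tendsto c
    refine squeeze_zero' (Eventually.of_forall fun _ => norm_nonneg _) ?_ hb
    filter_upwards [hev, hev2] with d hd hd2
    rw [invSub_sub_invSub hV hc hd, norm_smul]
    gcongr
    refine (norm_mul_le _ _).trans ?_
    gcongr
    · exact (norm_invSub_le hV hd).trans (inv_anti₀ (by positivity) hd2.le)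
    · exact norm_invSub_le hV hc
  rw [hasDerivAt_iff_tendsto_slope]
  refine ((hcont.mul_const (invSub hV c)).mono_left nhdsWithin_le_nhds).congr' ?_
  filter_upwards [self_mem_nhdsWithin, hev.filter_mono nhdsWithin_le_nhds] with d hdc hd
  rw [slope_def_module, invSub_sub_invSub hV hc hd, inv_smul_smul₀ (sub_ne_zero.2 hdc)]

end

/-- The zeroth-order coefficient `ε b₁ / (ε U - c) + b₂ / (ε U - c)²`. -/
noncomputable def rayleighPotential {U : ℝ → ℝ} (hU : Continuous U) (b₁ b₂ : ℝ →ᵇ ℂ) (ε : ℝ)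
    (c : ℂ) : ℝ →ᵇ ℂ :=
  (ε : ℂ) • (b₁ * invSub (hU.const_mul ε) c) +
    b₂ * (invSub (hU.const_mul ε) c * invSub (hU.const_mul ε) c)

section

variable {U : ℝ → ℝ} (hU : Continuous U) (b₁ b₂ : ℝ →ᵇ ℂ)

theorem rayleighPotential_apply (ε : ℝ) {c : ℂ} (hc : 0 < c.im) (y : ℝ) :
    rayleighPotential hU b₁ b₂ ε c y = ε * b₁ y / (ε * U y - c) + b₂ y / (ε * U y - c) ^ 2 := by
  simp only [rayleighPotential, BoundedContinuousFunction.coe_add, Pi.add_apply,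
    BoundedContinuousFunction.coe_smul, BoundedContinuousFunction.coe_mul, Pi.mul_apply,
    invSub_apply _ hc, smul_eq_mul]
  push_cast
  rw [div_eq_mul_inv, div_eq_mul_inv, pow_two, mul_inv]
  ring

theorem tendsto_rayleighPotential (hb₁ : Tendsto b₁ (cocompact ℝ) (𝓝 0))
    (hb₂ : Tendsto b₂ (cocompact ℝ) (𝓝 0)) (ε : ℝ) (c : ℂ) :
    Tendsto (rayleighPotential hU b₁ b₂ ε c) (cocompact ℝ) (𝓝 0) := by
  set w := invSub (hU.const_mul ε) c
  have hw : ∀ (b w : ℝ →ᵇ ℂ), Tendsto b (cocompact ℝ) (𝓝 0) →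
      Tendsto (fun y => b y * w y) (cocompact ℝ) (𝓝 0) := by
    intro b w hb
    have h1 := hb.norm.mul_const ‖w‖
    rw [norm_zero, zero_mul] at h1
    refine squeeze_zero_norm (fun y => ?_) h1
    rw [norm_mul]
    exact mul_le_mul_of_nonneg_left (w.norm_coe_le_norm y) (norm_nonneg _)
  have := ((hw b₁ w hb₁).const_mul (ε : ℂ)).add (hw b₂ (w * w) hb₂)
  rw [mul_zero, add_zero] at this
  exact this

theorem differentiableAt_rayleighPotential (ε : ℝ) {c : ℂ} (hc : 0 < c.im) :
    DifferentiableAt ℂ (rayleighPotential hU b₁ b₂ ε) c := by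
  have h := (hasDerivAt_invSub (hU.const_mul ε) hc).differentiableAt
  exact ((h.const_mul b₁).const_smul (ε : ℂ)).add ((h.mul h).const_mul b₂)

/-- As `ε → 0` the potential converges uniformly, also in `c`. Where `U` may be large, the decay of
`b₂` is used. -/
theorem rayleighPotential_sub_le (hb₂ : Tendsto b₂ (cocompact ℝ) (𝓝 0)) {δ : ℝ} (hδ : 0 < δ)
    {η : ℝ} (hη : 0 < η) : ∃ ε₀ > 0, ∀ ε : ℝ, |ε| < ε₀ → ∀ c : ℂ, δ ≤ c.im →
      ‖rayleighPotential hU b₁ b₂ ε c - rayleighPotential hU b₁ b₂ 0 c‖ ≤ η := by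
  have hev : ∀ᶠ y in cocompact ℝ, ‖b₂ y‖ < η * δ ^ 2 / 4 := by
    have := hb₂.norm
    rw [norm_zero] at this
    exact this.eventually_lt_const (by positivity)
  obtain ⟨K, hK, hKs⟩ := mem_cocompact.1 hev
  obtain ⟨M, hM⟩ := hK.exists_bound_of_continuousOn hU.continuousOn
  set M' := max M 0 with hM'
  have hM'0 : 0 ≤ M' := le_max_right _ _
  refine ⟨min (η * δ / (2 * (‖b₁‖ + 1))) (η * δ ^ 3 / (4 * (‖b₂‖ + 1) * (M' + 1))),
    by positivity, fun ε hε c hc => ?_⟩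
  have hc0 : 0 < c.im := hδ.trans_le hc
  have hε1 : |ε| * (2 * (‖b₁‖ + 1)) ≤ η * δ := by
    rw [← le_div_iff₀ (by positivity)]; exact (hε.trans_le (min_le_left _ _)).le
  have hε2 : |ε| * (4 * (‖b₂‖ + 1) * (M' + 1)) ≤ η * δ ^ 3 := by
    rw [← le_div_iff₀ (by positivity)]; exact (hε.trans_le (min_le_right _ _)).le
  rw [BoundedContinuousFunction.norm_le hη.le]
  intro y
  set w := invSub (hU.const_mul ε) c y with hw
  set w₀ := invSub (hU.const_mul 0) c y with hw₀
  have hnw : ∀ ε : ℝ, ‖invSub (hU.const_mul ε) c y‖ ≤ δ⁻¹ := fun ε =>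
    (BoundedContinuousFunction.norm_coe_le_norm _ y).trans
      ((norm_invSub_le _ hc0).trans (inv_anti₀ hδ hc))
  have hw1 : ‖w‖ ≤ δ⁻¹ := hnw ε
  have hw2 : ‖w₀‖ ≤ δ⁻¹ := hnw 0
  have hval : (rayleighPotential hU b₁ b₂ ε c - rayleighPotential hU b₁ b₂ 0 c) y =
      ε * (b₁ y * w) + b₂ y * (w * w - w₀ * w₀) := by
    simp only [rayleighPotential, BoundedContinuousFunction.coe_sub, Pi.sub_apply,
      BoundedContinuousFunction.coe_add, Pi.add_apply, BoundedContinuousFunction.coe_smul,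
      BoundedContinuousFunction.coe_mul, Pi.mul_apply, smul_eq_mul]
    simp only [hw, hw₀, Complex.ofReal_zero, zero_mul]
    ring
  have hfirst : ‖(ε : ℂ) * (b₁ y * w)‖ ≤ η / 2 := by
    rw [norm_mul, norm_mul, Complex.norm_real, Real.norm_eq_abs]
    calc |ε| * (‖b₁ y‖ * ‖w‖) ≤ |ε| * ((‖b₁‖ + 1) * δ⁻¹) := by
          gcongr
          linarith [b₁.norm_coe_le_norm y]
      _ ≤ η / 2 := by
          rw [← mul_assoc, ← div_eq_mul_inv, div_le_iff₀ hδ]; linarith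
  have hsecond : ‖b₂ y * (w * w - w₀ * w₀)‖ ≤ η / 2 := by
    rw [norm_mul]
    by_cases hy : y ∈ K
    · have hdiff : w - w₀ = -(ε * U y) * (w * w₀) := by
        rw [hw, hw₀, invSub_apply _ hc0, invSub_apply _ hc0]
        have h1 := ofReal_sub_ne_zero hc0 (ε * U y)
        have h2 := ofReal_sub_ne_zero hc0 (0 * U y)
        simp only [zero_mul, Complex.ofReal_zero, zero_sub, Complex.ofReal_mul] at h1 h2 ⊢
        have h3 : c ≠ 0 := neg_ne_zero.1 h2
        field_simp
        ring
      have hUy : ‖U y‖ ≤ M' := (hM y hy).trans (le_max_left _ _)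
      have e : w * w - w₀ * w₀ = (w - w₀) * (w + w₀) := by ring
      rw [e, hdiff, norm_mul, norm_mul, norm_neg, norm_mul, norm_mul, Complex.norm_real,
        Complex.norm_real]
      calc ‖b₂ y‖ * (‖ε‖ * ‖U y‖ * (‖w‖ * ‖w₀‖) * ‖w + w₀‖)
          ≤ (‖b₂‖ + 1) * (|ε| * (M' + 1) * (δ⁻¹ * δ⁻¹) * (δ⁻¹ + δ⁻¹)) := by
            gcongr
            · linarith [b₂.norm_coe_le_norm y]
            · exact le_rfl
            · linarith
            · exact (norm_add_le _ _).trans (add_le_add hw1 hw2)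
        _ = (|ε| * (4 * (‖b₂‖ + 1) * (M' + 1))) / (2 * δ ^ 3) := by
            field_simp
            ring
        _ ≤ (η * δ ^ 3) / (2 * δ ^ 3) := by gcongr
        _ = η / 2 := by field_simp
    · have h1 : ‖b₂ y‖ < η * δ ^ 2 / 4 := by
        by_contra hcon
        exact hy (by_contra fun h => hcon (hKs h))
      calc ‖b₂ y‖ * ‖w * w - w₀ * w₀‖ ≤ (η * δ ^ 2 / 4) * (δ⁻¹ * δ⁻¹ + δ⁻¹ * δ⁻¹) := by
            gcongr
            refine (norm_sub_le _ _).trans ?_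
            rw [norm_mul, norm_mul]
            gcongr
        _ = η / 2 := by field_simp; ring
  rw [hval]
  exact (norm_add_le _ _).trans (by linarith)

end

/-! ### An unstable mode in operator form -/

/-- For all small `ε` the operator of the Rayleigh equation has a kernel vector for some `c` with
`Im c > 0`. Here `a`, `b₁`, `b₂` stand for `ρ₀`, `(ρ₀ U')'`, `g ρ₀'`. -/
theorem exists_kernel_rayleigh {k : ℝ} (hk : 0 < k) {U : ℝ → ℝ} (hU : Continuous U)
    {a b₁ b₂ : ℝ →ᵇ ℂ} {α β : ℝ → ℝ} (ha : ∀ x, a x = α x) {m : ℝ} (hm : 0 < m)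
    (hα : ∀ x, m ≤ α x) (hb₂' : ∀ x, b₂ x = β x) (hβ : ∀ x, 0 < β x)
    (hb₁ : Tendsto b₁ (cocompact ℝ) (𝓝 0)) (hb₂ : Tendsto b₂ (cocompact ℝ) (𝓝 0)) :
    ∃ ε₀ > 0, ∀ ε : ℝ, |ε| < ε₀ → ∃ c : ℂ, 0 < c.im ∧ ∃ f : L2R, f ≠ 0 ∧
      (energyOp hk a + potentialOp hk (rayleighPotential hU b₁ b₂ ε c)) f = 0 := by
  set L := energyOp hk a with hL
  set B := potentialOp hk b₂ with hB
  have hLu : IsUnit L := energyOp_isUnit hk ha hm hα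
  have hLp : L.IsPositive := energyOp_isPositive hk ha fun x => hm.le.trans (hα x)
  have hBp : B.IsPositive := potentialOp_isPositive hk hb₂' fun x => (hβ x).le
  have hcoer := energyOp_coercive hk ha hm.le hα
  have hm2 : 0 < m / 2 := by positivity
  set X : ℝ → ℂ → L2R →L[ℂ] L2R := fun ε c =>
    L + potentialOp hk (rayleighPotential hU b₁ b₂ ε c) with hX
  have hcpt : ∀ ε c, IsCompactOperator (potentialOp hk (rayleighPotential hU b₁ b₂ ε c)) :=
    fun ε c => potentialOp_isCompactOperator hk (tendsto_rayleighPotential hU b₁ b₂ hb₁ hb₂ ε c)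
  have hker : ∀ ε c, ¬ IsUnit (X ε c) → ∃ f : L2R, f ≠ 0 ∧ X ε c f = 0 := fun ε c h =>
    exists_ne_zero_of_not_isUnit_add_compact hLu (hcpt ε c) h
  -- without shear the pencil is `L + c⁻² B`
  have hX0 : ∀ c : ℂ, 0 < c.im → ∀ v, X 0 c v = L v + (c ^ 2)⁻¹ • B v := by
    intro c hc v
    have hpot : rayleighPotential hU b₁ b₂ 0 c = (c ^ 2)⁻¹ • b₂ := by
      ext y
      rw [rayleighPotential_apply hU b₁ b₂ 0 hc]
      simp [div_eq_mul_inv, mul_comm]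
    simp only [hX, hpot]
    simp [hB, potentialOp]
  obtain ⟨μ, hμ, v, hv, hBv⟩ := exists_pos_pencil_eigenvalue hLp hLu hBp
    (potentialOp_isCompactOperator hk hb₂) (potentialOp_ne_zero hk hb₂' hβ)
  set σ := √μ with hσ
  have hσ0 : 0 < σ := Real.sqrt_pos.2 hμ
  have hσ2 : σ ^ 2 = μ := Real.sq_sqrt hμ.le
  have : Fact ((2 : ENNReal) ≠ ⊤) := ⟨ENNReal.ofNat_ne_top⟩
  have hctb := countable_pencil_eigenvalues hLp hm2 hcoer hBp
  set 𝓔 := {μ : ℝ | ∃ v : L2R, v ≠ 0 ∧ B v = (μ : ℂ) • L v} with hE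
  -- a radius for which neither of the two imaginary points of the circle is an eigenvalue
  obtain ⟨r, hr, hr1, hr2⟩ : ∃ r ∈ Set.Ioo 0 (σ / 2), (σ + r) ^ 2 ∉ 𝓔 ∧ (σ - r) ^ 2 ∉ 𝓔 := by
    set T := (Set.Ioo 0 (σ / 2) ∩ (fun r => (σ + r) ^ 2) ⁻¹' 𝓔) ∪
      (Set.Ioo 0 (σ / 2) ∩ (fun r => (σ - r) ^ 2) ⁻¹' 𝓔) with hT
    have hTc : T.Countable := by
      have hcp : ∀ (F : ℝ → ℝ), Set.InjOn F (Set.Ioo 0 (σ / 2)) →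
          (Set.Ioo 0 (σ / 2) ∩ F ⁻¹' 𝓔).Countable := fun F hF =>
        Set.MapsTo.countable_of_injOn (t := 𝓔) (fun x hx => hx.2) (hF.mono Set.inter_subset_left)
          hctb
      refine (hcp _ ?_).union (hcp _ ?_)
      · intro x hx y hy hxy
        have := hx.1; have := hy.1
        have h2 := (sq_eq_sq₀ (by linarith : 0 ≤ σ + x) (by linarith : 0 ≤ σ + y)).1 hxy
        linarith
      · intro x hx y hy hxy
        have := hx.2; have := hy.2
        have h2 := (sq_eq_sq₀ (by linarith : 0 ≤ σ - x) (by linarith : 0 ≤ σ - y)).1 hxy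
        linarith
    obtain ⟨r, hr, hrT⟩ := (hTc.dense_compl ℝ).inter_open_nonempty (Set.Ioo 0 (σ / 2)) isOpen_Ioo
      (Set.nonempty_Ioo.2 (by positivity))
    exact ⟨r, hr, fun h => hrT (Or.inl ⟨hr, h⟩), fun h => hrT (Or.inr ⟨hr, h⟩)⟩
  set z₀ : ℂ := Complex.I * σ with hz₀
  have him : ∀ z ∈ Metric.closedBall z₀ r, σ / 2 ≤ z.im := by
    intro z hz
    rw [mem_closedBall_iff_norm] at hz
    have h1 := (Complex.abs_im_le_norm (z - z₀)).trans hz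
    have h2 : (z - z₀).im = z.im - σ := by simp [hz₀]
    rw [h2, abs_le] at h1
    linarith [hr.2, h1.1]
  have him0 : ∀ z ∈ Metric.closedBall z₀ r, 0 < z.im := fun z hz =>
    lt_of_lt_of_le (by positivity) (him z hz)
  have hdiff : ∀ ε, ∀ z ∈ Metric.closedBall z₀ r, DifferentiableAt ℂ (X ε) z := by
    intro ε z hz
    have h1 := differentiableAt_rayleighPotential hU b₁ b₂ ε (him0 z hz)
    have h2 : DifferentiableAt ℂ (fun c => mulOp (rayleighPotential hU b₁ b₂ ε c)) z :=
      mulOp.differentiableAt.comp z h1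
    have h3 := ((h2.mul_const (isConvKernel_expKernel hk).convOp).const_mul
      (ContinuousLinearMap.adjoint (isConvKernel_expKernel hk).convOp)).const_add L
    exact h3
  obtain ⟨ε₀, hε₀, hε⟩ : ∃ ε₀ > 0, ∀ ε : ℝ, |ε| < ε₀ →
      ∃ z ∈ Metric.closedBall z₀ r, ¬ IsUnit (X ε z) := by
    refine exists_not_isUnit_of_perturbation hr.1
      (fun ε => DifferentiableOn.diffContOnCl_ball (U := Metric.closedBall z₀ r)
        (fun z hz => (hdiff ε z hz).differentiableWithinAt) subset_rfl) ?_ ?_ hv ?_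
    · intro η hη
      set S := (isConvKernel_expKernel hk).convOp with hS
      set N := ‖ContinuousLinearMap.adjoint S‖ * ‖S‖ with hN
      obtain ⟨ε₀, hε₀, hε⟩ := rayleighPotential_sub_le hU b₁ b₂ hb₂ (half_pos hσ0)
        (η := η / (N + 1)) (by positivity)
      refine ⟨ε₀, hε₀, fun ε he z hz => ?_⟩
      have h1 : X ε z - X 0 z = ContinuousLinearMap.adjoint S ∘L
          mulOp (rayleighPotential hU b₁ b₂ ε z - rayleighPotential hU b₁ b₂ 0 z) ∘L S := by
        ext1 f
        simp [hX, potentialOp, hS]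
      have h2 := (norm_mulOp_le _).trans (hε ε he z (him z hz))
      rw [h1]
      calc _ ≤ ‖ContinuousLinearMap.adjoint S‖ * (η / (N + 1) * ‖S‖) := by
            refine (ContinuousLinearMap.opNorm_comp_le _ _).trans ?_
            gcongr
            refine (ContinuousLinearMap.opNorm_comp_le _ _).trans ?_
            gcongr
        _ = η / (N + 1) * N := by rw [hN]; ring
        _ ≤ η := by
            have : 0 ≤ N := by positivity
            rw [div_mul_eq_mul_div, div_le_iff₀ (by positivity)]; nlinarith
    · intro z hz
      by_contra hcon
      have hzc := Metric.sphere_subset_closedBall hz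
      obtain ⟨f, hf, hXf⟩ := hker 0 z hcon
      have hz0 : 0 < z.im := him0 z hzc
      have hzne : z ≠ 0 := fun h => by simp [h] at hz0
      rw [hX0 z hz0] at hXf
      have hBf : B f = (-z ^ 2) • L f := by
        have h1 : L f = -((z ^ 2)⁻¹ • B f) := eq_neg_of_add_eq_zero_left hXf
        rw [h1, smul_neg, neg_smul, neg_neg, smul_inv_smul₀ (pow_ne_zero 2 hzne)]
      -- the eigenvalue `-z²` is real, so `z` is purely imaginary
      have hreal := pencil_eigenvalue_conj hLp hm2 hcoer hBp hf hBf
      have him2 : (-z ^ 2).im = 0 := Complex.conj_eq_iff_im.1 hreal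
      have hre : z.re = 0 := by
        rw [Complex.neg_im, pow_two, Complex.mul_im] at him2
        have : z.re * z.im = 0 := by linarith
        exact (mul_eq_zero.1 this).resolve_right hz0.ne'
      have hzI : z = Complex.I * z.im := by
        apply Complex.ext <;> simp [hre]
      have hmem : z.im ^ 2 ∈ 𝓔 := by
        refine ⟨f, hf, ?_⟩
        rw [hBf]
        congr 1
        conv_lhs => rw [hzI]
        rw [mul_pow, Complex.I_sq]
        push_cast
        ring
      have hdist : |z.im - σ| = r := by
        rw [mem_sphere_iff_norm, hzI, hz₀, ← mul_sub, norm_mul, Complex.norm_I, one_mul,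
          ← Complex.ofReal_sub, Complex.norm_real] at hz
        exact hz
      rcases (abs_eq hr.1.le).1 hdist with h | h
      · exact hr1 (by rwa [show σ + r = z.im by linarith])
      · exact hr2 (by rwa [show σ - r = z.im by linarith])
    · rw [hX0 z₀ (by simpa [hz₀] using hσ0), hBv, smul_smul]
      have : (z₀ ^ 2)⁻¹ * (μ : ℂ) = -1 := by
        rw [hz₀, mul_pow, Complex.I_sq, ← hσ2]
        have : (σ : ℂ) ≠ 0 := by exact_mod_cast hσ0.ne'
        push_cast
        field_simp
      rw [this]
      simp
  refine ⟨ε₀, hε₀, fun ε he => ?_⟩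
  obtain ⟨c, hc, hcu⟩ := hε ε he
  exact ⟨c, him0 c hc, hker ε c hcu⟩

/-! ### From the operator equation to a classical solution -/

/-- A kernel vector of `energyOp + potentialOp` is a square integrable classical solution
`(φ, p = ρ φ')` of the first-order system `ρ φ' = p`, `p' = (k² ρ + q) φ`. The kernel equation says
`p = S†(k p - (k² ρ + q) φ)`, and `φ = S(p / ρ + k φ)` by definition; both sides gain a derivative. -/
theorem exists_classical_solution_of_kernel {k : ℝ} (hk : 0 < k) {a q : ℝ →ᵇ ℂ} {α : ℝ → ℝ}
    (ha : ∀ x, a x = α x) (hα : ∀ x, 0 < α x) {f : L2R} (hf : f ≠ 0)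
    (hker : (energyOp hk a + potentialOp hk q) f = 0) :
    ∃ φ p : ℝ → ℂ, φ ≠ 0 ∧ MemLp φ 2 ∧ MemLp p 2 ∧ (∀ x, HasDerivAt φ (p x / α x) x) ∧
      ∀ x, HasDerivAt p (((k ^ 2 : ℝ) * α x + q x) * φ x) x := by
  set hh := isConvKernel_expKernel hk with hhdef
  set S := hh.convOp with hS
  set P := mulOp a (f - (k : ℂ) • S f) with hP
  set F := ((k ^ 2 : ℝ) : ℂ) • mulOp a (S f) + mulOp q (S f) with hF
  -- the kernel equation, as an identity between elements of `L²`
  have hPeq : P = hh.comp_neg.convOp ((k : ℂ) • P - F) := by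
    rw [← hh.adjoint_convOp, ← hS]
    have h1 : (energyOp hk a + potentialOp hk q) f =
        P - (k : ℂ) • ContinuousLinearMap.adjoint S P + ContinuousLinearMap.adjoint S F := by
      have h2 : ContinuousLinearMap.adjoint (1 - (k : ℂ) • S) =
          1 - (k : ℂ) • ContinuousLinearMap.adjoint S := by
        rw [← ContinuousLinearMap.star_eq_adjoint, ← ContinuousLinearMap.star_eq_adjoint,
          star_sub, star_one, star_smul]
        congr 2
        exact Complex.conj_ofReal k
      have h3 : (1 - (k : ℂ) • S) f = f - (k : ℂ) • S f := rfl
      rw [add_apply, energyOp, add_apply, potentialOp, ← hhdef, ← hS, h2, smul_apply]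
      simp only [ContinuousLinearMap.comp_apply, h3, ← hP]
      have h4 : (1 - (k : ℂ) • ContinuousLinearMap.adjoint S) P =
          P - (k : ℂ) • ContinuousLinearMap.adjoint S P := rfl
      rw [h4, hF, map_add, map_smul, add_assoc]
    rw [h1] at hker
    rw [map_sub, map_smul, ← sub_eq_zero, ← hker]
    abel
  set φ : ℝ → ℂ := expConv k f with hφ
  have hφS : S f =ᵐ[volume] φ := by
    filter_upwards [hh.coeFn_convOp f] with x hx
    rw [hx, hh.conv_eq_integral]
    rfl
  have hφ2 : MemLp φ 2 := (Lp.memLp (S f)).ae_eq hφS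
  have hφc : Continuous φ := continuous_expConv hk (Lp.memLp f)
  set V : ℝ → ℂ := fun x => ((k ^ 2 : ℝ) * α x + q x) * φ x with hV
  have hac : Continuous fun x => (α x : ℂ) := by
    have : (fun x => (α x : ℂ)) = a := funext fun x => (ha x).symm
    rw [this]; exact a.continuous
  have hVc : Continuous V := by
    have := q.continuous
    fun_prop
  have hFV : F =ᵐ[volume] V := by
    filter_upwards [Lp.coeFn_add (((k ^ 2 : ℝ) : ℂ) • mulOp a (S f)) (mulOp q (S f)),
      Lp.coeFn_smul ((k ^ 2 : ℝ) : ℂ) (mulOp a (S f)), coeFn_mulOp a (S f), coeFn_mulOp q (S f),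
      hφS] with x h1 h2 h3 h4 h5
    rw [hF, h1, Pi.add_apply, h2, Pi.smul_apply, h3, h4, h5, ha, hV, smul_eq_mul]
    ring
  set G : L2R := (k : ℂ) • P - F with hG
  set p : ℝ → ℂ := fun x => expConv k (fun y => G (-y)) (-x) with hp
  have hPp : P =ᵐ[volume] p := by
    have h1 := hh.comp_neg.coeFn_convOp G
    rw [← hPeq] at h1
    filter_upwards [h1] with x hx
    rw [hx, hh.comp_neg.conv_eq_integral]
    exact integral_expKernel_reflect k G x
  have hp2 : MemLp p 2 := (Lp.memLp P).ae_eq hPp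
  have hpc : Continuous p := (continuous_expConv hk (Lp.memLp G).comp_neg).comp continuous_neg
  have hGg : G =ᵐ[volume] fun x => k * p x - V x := by
    filter_upwards [Lp.coeFn_sub ((k : ℂ) • P) F, Lp.coeFn_smul (k : ℂ) P, hPp, hFV]
      with x h1 h2 h3 h4
    rw [hG, h1, Pi.sub_apply, h2, Pi.smul_apply, h3, h4, smul_eq_mul]
  have hg2 : MemLp (fun x => k * p x - V x) 2 := (Lp.memLp G).ae_eq hGg
  have hpeq : ∀ x, p x = expConv k (fun y => k * p (-y) - V (-y)) (-x) := by
    intro x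
    have h1 := (Measure.measurePreserving_neg (volume : Measure ℝ)).quasiMeasurePreserving.ae_eq_comp
      hGg
    change expConv k (fun y => G (-y)) (-x) = _
    refine integral_congr_ae ?_
    filter_upwards [h1] with y hy
    have hy' : G (-y) = k * p (-y) - V (-y) := hy
    simp only [hy']
  have hpd : ∀ x, HasDerivAt p (V x) x := by
    intro x
    have h1 := hasDerivAt_expConv hk hg2.comp_neg
      (((continuous_const.mul hpc).sub hVc).comp continuous_neg) (-x)
    have h2 := h1.scomp x (hasDerivAt_neg x)
    refine (h2.congr_of_eventuallyEq (Eventually.of_forall hpeq)).congr_deriv ?_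
    rw [← hpeq x]
    simp
  have hff : f =ᵐ[volume] fun x => p x / α x + k * φ x := by
    filter_upwards [hPp, coeFn_mulOp a (f - (k : ℂ) • S f), Lp.coeFn_sub f ((k : ℂ) • S f),
      Lp.coeFn_smul (k : ℂ) (S f), hφS] with x h1 h2 h3 h4 h5
    have hne : (α x : ℂ) ≠ 0 := by exact_mod_cast (hα x).ne'
    rw [hP, h2, h3, Pi.sub_apply, h4, Pi.smul_apply, h5, ha, smul_eq_mul] at h1
    rw [← h1]
    field_simp
    ring
  have hfc : Continuous fun x => p x / α x + k * φ x :=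
    (hpc.div hac fun x => by exact_mod_cast (hα x).ne').add (continuous_const.mul hφc)
  have hφeq : φ = expConv k fun x => p x / α x + k * φ x := by
    ext x
    rw [hφ]
    refine integral_congr_ae ?_
    filter_upwards [hff] with y hy
    rw [hy]
  have hφd : ∀ x, HasDerivAt φ (p x / α x) x := by
    intro x
    have h1 := hasDerivAt_expConv hk ((Lp.memLp f).ae_eq hff) hfc x
    rw [← hφeq] at h1
    exact h1.congr_deriv (by ring)
  refine ⟨φ, p, fun h0 => hf ?_, hφ2, hp2, hφd, hpd⟩
  rw [Lp.eq_zero_iff_ae_eq_zero]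
  filter_upwards [hff] with x hx
  have h1 := hφd x
  rw [h0] at h1
  have h2 := h1.unique (hasDerivAt_const x (0 : ℂ))
  rw [hx, h2, h0]
  simp

/-! ### Sobolev regularity -/

section Sobolev

open TemperedDistribution FourierTransform
open scoped LineDeriv Real

/-- If a distribution and its derivative have Sobolev order `s`, the distribution has order
`s + 1`: the Bessel potential of order `2` is `1 - (2π)⁻² ∂²`. -/
theorem memSobolev_add_one_of_lineDeriv {s : ℝ} {f : 𝓢'(ℝ, ℂ)} (hf : MemSobolev s 2 f)
    (hf' : MemSobolev s 2 (∂_{(1 : ℝ)} f)) : MemSobolev (s + 1) 2 f := by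
  set g : ℝ → ℂ := fun x => Complex.ofReal (inner ℝ x 1) with hg
  have hgt : g.HasTemperateGrowth := by fun_prop
  have hggt : (g * g).HasTemperateGrowth := by
    simp only [hg, Pi.mul_def]; fun_prop
  have hFM : ∀ h : 𝓢'(ℝ, ℂ), fourierMultiplierCLM ℂ g h =
      (2 * π * Complex.I)⁻¹ • ∂_{(1 : ℝ)} h := by
    intro h
    rw [lineDeriv_eq_fourierMultiplierCLM, inv_smul_smul₀]
    simp [Real.pi_ne_zero]
  have hB : besselPotential ℝ ℂ 2 f =
      f + fourierMultiplierCLM ℂ g (fourierMultiplierCLM ℂ g f) := by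
    rw [fourierMultiplierCLM_fourierMultiplierCLM_apply hgt hgt, besselPotential]
    have h1 : (fun x : ℝ => Complex.ofReal ((1 + ‖x‖ ^ 2) ^ ((2 : ℝ) / 2))) =
        (fun _ => (1 : ℂ)) + g * g := by
      ext x
      simp [hg, pow_two, ← Complex.ofReal_mul]
    rw [h1, fourierMultiplierCLM_apply, smulLeftCLM_add (by fun_prop) hggt, add_apply,
      FourierTransform.fourierInv_add, smulLeftCLM_const, one_smul,
      FourierTransform.fourierInv_fourier_eq]
    rfl
  have h2 : MemSobolev (s - 1) 2 (besselPotential ℝ ℂ 2 f) := by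
    rw [hB]
    refine (hf.mono (by linarith)).add ?_
    rw [hFM, hFM]
    exact (hf'.smul _).lineDerivOp.smul _
  have := memSobolev_besselPotential_iff.1 h2
  rwa [show (2 : ℝ) + (s - 1) = s + 1 by ring] at this

theorem inSobolev_zero {f : ℝ → ℂ} (hf : MemLp f 2) : InSobolev 0 f :=
  ⟨hf, memSobolev_zero_iff.2 ⟨_, rfl⟩⟩

theorem InSobolev.mono {s t : ℝ} (h : s ≤ t) {f : ℝ → ℂ} (hf : InSobolev t f) : InSobolev s f :=
  ⟨hf.1, hf.2.mono h⟩

theorem InSobolev.add_one {s : ℝ} {f f' : ℝ → ℂ} (hf : InSobolev s f) (hf' : InSobolev s f')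
    (hd : ∀ x, HasDerivAt f (f' x) x) : InSobolev (s + 1) f := by
  obtain ⟨h, hs⟩ := hf
  obtain ⟨h', hs'⟩ := hf'
  refine ⟨h, memSobolev_add_one_of_lineDeriv hs ?_⟩
  convert hs' using 1
  ext g
  rw [lineDerivOp_apply_apply, Lp.toTemperedDistribution_apply, Lp.toTemperedDistribution_apply]
  have hg : MemLp g 2 := g.memLp 2 volume
  have hg' : MemLp (deriv g) 2 := (SchwartzMap.derivCLM ℂ ℂ g).memLp 2 volume
  have e1 : ∫ x, (-(∂_{(1 : ℝ)} g)) x • h.toLp f x = -∫ x, f x * deriv g x := by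
    rw [← integral_neg]
    refine integral_congr_ae ?_
    filter_upwards [h.coeFn_toLp] with x hx
    rw [hx]
    change (-(∂_{(1 : ℝ)} g) x) • f x = _
    rw [SchwartzMap.lineDerivOp_apply_eq_fderiv, fderiv_apply_one_eq_deriv, smul_eq_mul]
    ring
  have e2 : ∫ x, g x • h'.toLp f' x = ∫ x, f' x * g x := by
    refine integral_congr_ae ?_
    filter_upwards [h'.coeFn_toLp] with x hx
    rw [hx, smul_eq_mul, mul_comm]
  rw [e1, e2, integral_mul_deriv_eq_deriv_mul_of_integrable (u := f) (u' := f')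
    (fun x _ => hd x) (fun x _ => g.differentiableAt.hasDerivAt) (h.integrable_mul hg')
    (h'.integrable_mul hg) (h.integrable_mul hg), neg_neg]

end Sobolev

/-! ### Functions with bounded derivatives -/

/-- `f` is `n` times differentiable and its derivatives of order `0, …, n` are bounded, the last one
being continuous. -/
def BoundedDerivs : ℕ → (ℝ → ℂ) → Prop
  | 0, f => Continuous f ∧ ∃ C, ∀ x, ‖f x‖ ≤ C
  | n + 1, f => (∃ C, ∀ x, ‖f x‖ ≤ C) ∧ Differentiable ℝ f ∧ BoundedDerivs n (deriv f)

namespace BoundedDerivs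

variable {n : ℕ} {f g : ℝ → ℂ}

theorem bounded (hf : BoundedDerivs n f) : ∃ C, ∀ x, ‖f x‖ ≤ C := by
  cases n with
  | zero => exact hf.2
  | succ n => exact hf.1

theorem continuous (hf : BoundedDerivs n f) : Continuous f := by
  cases n with
  | zero => exact hf.1
  | succ n => exact hf.2.1.continuous

theorem of_succ (hf : BoundedDerivs (n + 1) f) : BoundedDerivs n f := by
  induction n generalizing f with
  | zero => exact ⟨hf.continuous, hf.1⟩
  | succ n ih => exact ⟨hf.1, hf.2.1, ih hf.2.2⟩

theorem succ_of_hasDerivAt {f' : ℝ → ℂ} (hb : ∃ C, ∀ x, ‖f x‖ ≤ C)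
    (hd : ∀ x, HasDerivAt f (f' x) x) (hf' : BoundedDerivs n f') : BoundedDerivs (n + 1) f := by
  refine ⟨hb, fun x => (hd x).differentiableAt, ?_⟩
  rwa [show deriv f = f' from funext fun x => (hd x).deriv]

theorem const (c : ℂ) : BoundedDerivs n (fun _ => c) := by
  induction n generalizing c with
  | zero => exact ⟨continuous_const, ‖c‖, fun _ => le_rfl⟩
  | succ n ih =>
    exact succ_of_hasDerivAt ⟨‖c‖, fun _ => le_rfl⟩
      (fun x => hasDerivAt_const x c) (ih 0)

theorem bounded_add (hf : ∃ C, ∀ x, ‖f x‖ ≤ C) (hg : ∃ C, ∀ x, ‖g x‖ ≤ C) :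
    ∃ C, ∀ x, ‖f x + g x‖ ≤ C := by
  obtain ⟨C, hC⟩ := hf
  obtain ⟨D, hD⟩ := hg
  exact ⟨C + D, fun x => (norm_add_le _ _).trans (add_le_add (hC x) (hD x))⟩

theorem bounded_mul (hf : ∃ C, ∀ x, ‖f x‖ ≤ C) (hg : ∃ C, ∀ x, ‖g x‖ ≤ C) :
    ∃ C, ∀ x, ‖f x * g x‖ ≤ C := by
  obtain ⟨C, hC⟩ := hf
  obtain ⟨D, hD⟩ := hg
  exact ⟨C * D, fun x => (norm_mul_le _ _).trans
    (mul_le_mul (hC x) (hD x) (norm_nonneg _) ((norm_nonneg _).trans (hC x)))⟩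

theorem add (hf : BoundedDerivs n f) (hg : BoundedDerivs n g) :
    BoundedDerivs n (fun x => f x + g x) := by
  induction n generalizing f g with
  | zero => exact ⟨hf.1.add hg.1, bounded_add hf.2 hg.2⟩
  | succ n ih =>
    exact succ_of_hasDerivAt (bounded_add hf.1 hg.1)
      (fun x => (hf.2.1 x).hasDerivAt.add (hg.2.1 x).hasDerivAt) (ih hf.2.2 hg.2.2)

theorem mul (hf : BoundedDerivs n f) (hg : BoundedDerivs n g) :
    BoundedDerivs n (fun x => f x * g x) := by
  induction n generalizing f g with
  | zero => exact ⟨hf.1.mul hg.1, bounded_mul hf.2 hg.2⟩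
  | succ n ih =>
    exact succ_of_hasDerivAt (bounded_mul hf.1 hg.1)
      (fun x => (hf.2.1 x).hasDerivAt.mul (hg.2.1 x).hasDerivAt)
      ((ih hf.2.2 hg.of_succ).add (ih hf.of_succ hg.2.2))

/-- A bounded solution of the Riccati equation `w' = A w²`, such as a reciprocal, is one order
smoother than `A`. -/
theorem of_riccati {A w : ℝ → ℂ} (hb : ∃ C, ∀ x, ‖w x‖ ≤ C)
    (hd : ∀ x, HasDerivAt w (A x * (w x * w x)) x) (hA : BoundedDerivs n A) :
    BoundedDerivs (n + 1) w := by
  induction n with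
  | zero =>
    have h0 : BoundedDerivs 0 w :=
      ⟨continuous_iff_continuousAt.2 fun x => (hd x).continuousAt, hb⟩
    exact succ_of_hasDerivAt hb hd (hA.mul (h0.mul h0))
  | succ n ih =>
    have h1 := ih hA.of_succ
    exact succ_of_hasDerivAt hb hd (hA.mul (h1.mul h1))

/-- Only derivatives of order at least one are controlled, so the conclusion is about `u'`. -/
theorem of_smoothWithBoundedDerivs {u : ℝ → ℝ} (hu : SmoothWithBoundedDerivs u) (n : ℕ) :
    BoundedDerivs n (fun x => ((deriv u x : ℝ) : ℂ)) := by
  have key : ∀ j, 1 ≤ j → BoundedDerivs n (fun x => ((iteratedDeriv j u x : ℝ) : ℂ)) := by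
    have hb : ∀ j, 1 ≤ j → ∃ C, ∀ x, ‖((iteratedDeriv j u x : ℝ) : ℂ)‖ ≤ C := fun j hj => by
      simpa using hu.2 j hj
    have hdiff : ∀ j, Differentiable ℝ (iteratedDeriv j u) := fun j =>
      hu.1.differentiable_iteratedDeriv j (by exact_mod_cast WithTop.coe_lt_top (j : ℕ))
    induction n with
    | zero => exact fun j hj =>
        ⟨Complex.continuous_ofReal.comp (hdiff j).continuous, hb j hj⟩
    | succ n ih =>
      refine fun j hj => succ_of_hasDerivAt (hb j hj) (fun x => ?_) (ih (j + 1) (by omega))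
      have := (hdiff j x).hasDerivAt.ofReal_comp
      rwa [← iteratedDeriv_succ] at this
  simpa using key 1 le_rfl

theorem memLp_mul (hf : BoundedDerivs n f) (hg : MemLp g 2) : MemLp (fun x => f x * g x) 2 := by
  obtain ⟨C, hC⟩ := hf.bounded
  exact MemLp.of_le_mul (c := C) hg (hf.continuous.aestronglyMeasurable.mul hg.1)
    (Eventually.of_forall fun x => by
      rw [norm_mul]; exact mul_le_mul_of_nonneg_right (hC x) (norm_nonneg _))

end BoundedDerivs

/-- Bootstrap for the system `φ' = R p`, `p' = Q φ`: combinations `a φ + b p` are stable under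
differentiation, so their Sobolev order is limited only by the smoothness of the coefficients. -/
theorem inSobolev_of_system {φ p Q R : ℝ → ℂ} (hφ2 : MemLp φ 2) (hp2 : MemLp p 2)
    (hφ : ∀ x, HasDerivAt φ (R x * p x) x) (hp : ∀ x, HasDerivAt p (Q x * φ x) x) {n : ℕ}
    (hQ : BoundedDerivs n Q) (hR : BoundedDerivs n R) {a b : ℝ → ℂ}
    (ha : BoundedDerivs (n + 1) a) (hb : BoundedDerivs (n + 1) b) :
    InSobolev ((n + 1 : ℕ) : ℝ) (fun x => a x * φ x + b x * p x) := by
  have hzero : ∀ {m : ℕ} {a b : ℝ → ℂ}, BoundedDerivs m a → BoundedDerivs m b →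
      InSobolev 0 (fun x => a x * φ x + b x * p x) := fun ha hb =>
    inSobolev_zero ((ha.memLp_mul hφ2).add (hb.memLp_mul hp2))
  have hder : ∀ {m : ℕ} {a b : ℝ → ℂ}, BoundedDerivs (m + 1) a → BoundedDerivs (m + 1) b →
      ∀ x, HasDerivAt (fun x => a x * φ x + b x * p x)
        ((deriv a x + b x * Q x) * φ x + (deriv b x + a x * R x) * p x) x := by
    intro m a b ha hb x
    refine (((ha.2.1 x).hasDerivAt.mul (hφ x)).add
      ((hb.2.1 x).hasDerivAt.mul (hp x))).congr_deriv ?_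
    ring
  induction n generalizing a b with
  | zero =>
    have h1 := hzero (m := 0) (ha.2.2.add (hb.of_succ.mul hQ)) (hb.2.2.add (ha.of_succ.mul hR))
    simpa using (hzero ha hb).add_one h1 (hder ha hb)
  | succ n ih =>
    have h1 := ih hQ.of_succ hR.of_succ (ha.2.2.add (hb.of_succ.mul hQ))
      (hb.2.2.add (ha.of_succ.mul hR))
    have h2 := ih hQ.of_succ hR.of_succ ha.of_succ hb.of_succ
    have h3 := h2.add_one h1 (hder ha hb)
    exact_mod_cast h3

/-! ### The Rayleigh system -/

/-- A continuous real function vanishing at infinity, as a bounded continuous complex function. -/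
theorem exists_boundedContinuous_of_tendsto_zero {F : ℝ → ℝ} (hF : Continuous F)
    (h0 : Tendsto F (cocompact ℝ) (𝓝 0)) :
    ∃ b : ℝ →ᵇ ℂ, (∀ x, b x = F x) ∧ Tendsto b (cocompact ℝ) (𝓝 0) := by
  have h1 : Tendsto (fun x => (F x : ℂ)) (cocompact ℝ) (𝓝 0) := by
    have := (Complex.continuous_ofReal.tendsto 0).comp h0
    rw [Complex.ofReal_zero] at this
    exact this
  let z : ZeroAtInftyContinuousMap ℝ ℂ :=
    { toFun := fun x => (F x : ℂ)
      continuous_toFun := Complex.continuous_ofReal.comp hF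
      zero_at_infty' := h1 }
  exact ⟨z.toBCF, fun _ => rfl, h1⟩

theorem BoundedContinuousFunction.boundedDerivs_zero {b : ℝ →ᵇ ℂ} {F : ℝ → ℝ}
    (hb : ∀ x, b x = F x) : BoundedDerivs 0 (fun x => (F x : ℂ)) := by
  rw [show (fun x => (F x : ℂ)) = b from funext fun x => (hb x).symm]
  exact ⟨b.continuous, ‖b‖, b.norm_coe_le_norm⟩

theorem theorem3p2
    (g : ℝ) (hg : 0 < g)
    (U ρ₀ : ℝ → ℝ)
    (hU : ContDiff ℝ 3 U) (hρ : ContDiff ℝ 3 ρ₀)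
    (hU1 : Tendsto (deriv U) (cocompact ℝ) (𝓝 0))
    (hU2 : Tendsto (deriv (deriv U)) (cocompact ℝ) (𝓝 0))
    (hρ1 : Tendsto (deriv ρ₀) (cocompact ℝ) (𝓝 0))
    (hρ2 : Tendsto (deriv (deriv ρ₀)) (cocompact ℝ) (𝓝 0))
    (hρpos : ∀ y : ℝ, 0 < ρ₀ y)
    (ρminus ρplus : ℝ) (hρminus : 0 < ρminus) (hρplus : 0 < ρplus)
    (hlimminus : Tendsto ρ₀ atBot (𝓝 ρminus))
    (hlimplus : Tendsto ρ₀ atTop (𝓝 ρplus))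
    (hU' : ∀ y : ℝ, deriv U y ≠ 0)
    (hρ' : ∀ y : ℝ, 0 < deriv ρ₀ y)
    (k : ℕ) (hk : 1 ≤ k) :
    ∃ ε₀ : ℝ, 0 < ε₀ ∧ ∀ ε : ℝ, |ε| < ε₀ →
      ∃ (c : ℂ) (φ r : ℝ → ℂ),
        0 < c.im ∧
        IsRayleighSolution g k (fun y => ε * U y) ρ₀ c φ r ∧
        InSobolev 2 φ ∧ InSobolev 1 r ∧
        (SmoothWithBoundedDerivs U → SmoothWithBoundedDerivs ρ₀ →
          ∀ m : ℝ, 0 < m → InSobolev m φ ∧ InSobolev m r) := by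
  have hk0 : (0 : ℝ) < k := by exact_mod_cast hk
  -- regularity of the profiles
  have hdU : ContDiff ℝ 2 (deriv U) := hU.deriv' (n := 2)
  have hddU : ContDiff ℝ 1 (deriv (deriv U)) := hdU.deriv' (n := 1)
  have hdρ : ContDiff ℝ 2 (deriv ρ₀) := hρ.deriv' (n := 2)
  have hddρ : ContDiff ℝ 1 (deriv (deriv ρ₀)) := hdρ.deriv' (n := 1)
  have hUd : ∀ y, HasDerivAt U (deriv U y) y := fun y =>
    (hU.differentiable (by norm_num) y).hasDerivAt
  have hρd : ∀ y, HasDerivAt ρ₀ (deriv ρ₀ y) y := fun y =>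
    (hρ.differentiable (by norm_num) y).hasDerivAt
  have hdUd : ∀ y, HasDerivAt (deriv U) (deriv (deriv U) y) y := fun y =>
    (hdU.differentiable (by norm_num) y).hasDerivAt
  have hdρd : ∀ y, HasDerivAt (deriv ρ₀) (deriv (deriv ρ₀) y) y := fun y =>
    (hdρ.differentiable (by norm_num) y).hasDerivAt
  -- bounds for the density
  have hmono : Monotone ρ₀ := (strictMono_of_deriv_pos hρ').monotone
  have hlow : ∀ y, ρminus ≤ ρ₀ y := fun y => hmono.le_of_tendsto hlimminus y
  have hup : ∀ y, ρ₀ y ≤ ρplus := fun y => hmono.ge_of_tendsto hlimplus y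
  let a : ℝ →ᵇ ℂ := BoundedContinuousFunction.ofNormedAddCommGroup (fun y => (ρ₀ y : ℂ))
    (Complex.continuous_ofReal.comp hρ.continuous) ρplus fun y => by
      rw [Complex.norm_real, Real.norm_eq_abs, abs_of_pos (hρpos y)]
      exact hup y
  have ha : ∀ y, a y = ρ₀ y := fun _ => rfl
  -- the coefficients `(ρ₀ U')'` and `g ρ₀'`
  set F₁ : ℝ → ℝ := fun y => deriv ρ₀ y * deriv U y + ρ₀ y * deriv (deriv U) y with hF₁
  have hF₁d : ∀ y, HasDerivAt (fun z => ρ₀ z * deriv U z) (F₁ y) y := fun y =>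
    (hρd y).mul (hdUd y)
  have hF₁0 : Tendsto F₁ (cocompact ℝ) (𝓝 0) := by
    have h1 : Tendsto (fun y => ρ₀ y * deriv (deriv U) y) (cocompact ℝ) (𝓝 0) := by
      have h2 := hU2.norm.const_mul ρplus
      rw [norm_zero, mul_zero] at h2
      refine squeeze_zero_norm (fun y => ?_) h2
      rw [norm_mul, Real.norm_eq_abs, abs_of_pos (hρpos y)]
      exact mul_le_mul_of_nonneg_right (hup y) (norm_nonneg _)
    have := (hρ1.mul hU1).add h1
    rwa [mul_zero, add_zero] at this
  obtain ⟨b₁, hb₁, hb₁0⟩ := exists_boundedContinuous_of_tendsto_zero (F := F₁)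
    ((hdρ.continuous.mul hdU.continuous).add (hρ.continuous.mul hddU.continuous)) hF₁0
  obtain ⟨b₂, hb₂, hb₂0⟩ := exists_boundedContinuous_of_tendsto_zero
    (F := fun y => g * deriv ρ₀ y) (continuous_const.mul hdρ.continuous)
    (by simpa using hρ1.const_mul g)
  obtain ⟨ε₀, hε₀, hε⟩ := exists_kernel_rayleigh hk0 hU.continuous ha hρminus hlow hb₂
    (fun y => mul_pos hg (hρ' y)) hb₁0 hb₂0
  refine ⟨ε₀, hε₀, fun ε he => ?_⟩
  obtain ⟨c, hc, f, hf, hker⟩ := hε ε he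
  obtain ⟨φ, p, hφ0, hφ2, hp2, hφd, hpd⟩ :=
    exists_classical_solution_of_kernel hk0 ha hρpos hf hker
  -- the system in the form `φ' = R p`, `p' = Q φ`
  set w : ℝ → ℂ := fun y => ((ε * U y : ℝ) - c)⁻¹ with hw
  set R : ℝ → ℂ := fun y => (ρ₀ y : ℂ)⁻¹ with hR
  set Q : ℝ → ℂ := fun y => ((k ^ 2 : ℝ) : ℂ) * ρ₀ y +
    (ε * (F₁ y * w y) + ((g * deriv ρ₀ y : ℝ) : ℂ) * (w y * w y)) with hQ
  have hVc : ∀ y, ((ε * U y : ℝ) : ℂ) - c ≠ 0 := fun y => ofReal_sub_ne_zero hc _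
  have hρne : ∀ y, (ρ₀ y : ℂ) ≠ 0 := fun y => by exact_mod_cast (hρpos y).ne'
  have hφR : ∀ y, HasDerivAt φ (R y * p y) y := fun y => by
    rw [hR, mul_comm, ← div_eq_mul_inv]; exact hφd y
  have hpQ : ∀ y, HasDerivAt p (Q y * φ y) y := by
    intro y
    refine (hpd y).congr_deriv ?_
    rw [rayleighPotential_apply _ _ _ _ hc, hb₁, hb₂]
    simp only [hQ, hw, div_eq_mul_inv, pow_two, mul_inv]
    push_cast
    ring
  -- bounds for the coefficients and their derivatives
  have hwb : ∃ C, ∀ y, ‖w y‖ ≤ C :=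
    ⟨‖invSub (hU.continuous.const_mul ε) c‖, fun y => by
      have := (invSub (hU.continuous.const_mul ε) c).norm_coe_le_norm y
      rwa [invSub_apply _ hc] at this⟩
  have hRb : ∃ C, ∀ y, ‖R y‖ ≤ C := ⟨ρminus⁻¹, fun y => by
    rw [norm_inv, Complex.norm_real, Real.norm_eq_abs, abs_of_pos (hρpos y)]
    exact inv_anti₀ hρminus (hlow y)⟩
  have hwd : ∀ y, HasDerivAt w (-ε * ((deriv U y : ℝ) : ℂ) * (w y * w y)) y := by
    intro y
    have h1 : HasDerivAt (fun y => ((ε * U y : ℝ) : ℂ) - c) ((ε * deriv U y : ℝ) : ℂ) y :=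
      (((hUd y).const_mul ε).ofReal_comp).sub_const c
    refine (h1.inv (hVc y)).congr_deriv ?_
    rw [hw, div_eq_mul_inv, pow_two, mul_inv]
    push_cast
    ring
  have hRd : ∀ y, HasDerivAt R (-1 * ((deriv ρ₀ y : ℝ) : ℂ) * (R y * R y)) y := by
    intro y
    refine ((hρd y).ofReal_comp.inv (hρne y)).congr_deriv ?_
    rw [hR, div_eq_mul_inv, pow_two, mul_inv]
    ring
  have hρBD : ∀ {n : ℕ}, BoundedDerivs n (fun y => ((deriv ρ₀ y : ℝ) : ℂ)) →
      BoundedDerivs (n + 1) (fun y => (ρ₀ y : ℂ)) := fun h =>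
    BoundedDerivs.succ_of_hasDerivAt ⟨‖a‖, a.norm_coe_le_norm⟩ (fun y => (hρd y).ofReal_comp) h
  have hwBD : ∀ {n : ℕ}, BoundedDerivs n (fun y => ((deriv U y : ℝ) : ℂ)) →
      BoundedDerivs (n + 1) w := fun h =>
    BoundedDerivs.of_riccati hwb hwd ((BoundedDerivs.const _).mul h)
  have hRBD : ∀ {n : ℕ}, BoundedDerivs n (fun y => ((deriv ρ₀ y : ℝ) : ℂ)) →
      BoundedDerivs (n + 1) R := fun h =>
    BoundedDerivs.of_riccati hRb hRd ((BoundedDerivs.const _).mul h)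
  have hQBD : ∀ {n : ℕ}, BoundedDerivs n (fun y => ((deriv ρ₀ y : ℝ) : ℂ)) →
      BoundedDerivs n (fun y => ((deriv U y : ℝ) : ℂ)) → BoundedDerivs n (fun y => (F₁ y : ℂ)) →
      BoundedDerivs n Q := by
    intro n h1 h2 h3
    have hw' := (hwBD h2).of_succ
    refine ((BoundedDerivs.const _).mul (hρBD h1).of_succ).add
      (((BoundedDerivs.const _).mul (h3.mul hw')).add (BoundedDerivs.mul ?_ (hw'.mul hw')))
    simpa using (BoundedDerivs.const (g : ℂ)).mul h1
  obtain ⟨d₁, hd₁, -⟩ := exists_boundedContinuous_of_tendsto_zero hdρ.continuous hρ1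
  obtain ⟨d₂, hd₂, -⟩ := exists_boundedContinuous_of_tendsto_zero hddρ.continuous hρ2
  obtain ⟨d₃, hd₃, -⟩ := exists_boundedContinuous_of_tendsto_zero hdU.continuous hU1
  have hρ1BD : BoundedDerivs 1 (fun y => ((deriv ρ₀ y : ℝ) : ℂ)) :=
    BoundedDerivs.succ_of_hasDerivAt (BoundedContinuousFunction.boundedDerivs_zero hd₁).bounded
      (fun y => (hdρd y).ofReal_comp) (BoundedContinuousFunction.boundedDerivs_zero hd₂)
  have hU0BD : BoundedDerivs 0 (fun y => ((deriv U y : ℝ) : ℂ)) :=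
    BoundedContinuousFunction.boundedDerivs_zero hd₃
  have hQ0 : BoundedDerivs 0 Q :=
    hQBD hρ1BD.of_succ hU0BD (BoundedContinuousFunction.boundedDerivs_zero hb₁)
  have hR1 : BoundedDerivs 1 R := hRBD hρ1BD.of_succ
  have hrcoef : ∀ {n : ℕ}, BoundedDerivs n (fun y => ((deriv ρ₀ y : ℝ) : ℂ)) →
      BoundedDerivs n w → BoundedDerivs n (fun y => -1 * (((deriv ρ₀ y : ℝ) : ℂ) * w y)) :=
    fun h1 h2 => (BoundedDerivs.const _).mul (h1.mul h2)
  set r : ℝ → ℂ := fun y => -1 * (((deriv ρ₀ y : ℝ) : ℂ) * w y) * φ y with hr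
  have hφform : (fun y => 1 * φ y + 0 * p y) = φ := by ext y; simp
  have hrform : (fun y => -1 * (((deriv ρ₀ y : ℝ) : ℂ) * w y) * φ y + 0 * p y) = r := by
    ext y; simp [hr]
  have hderivφ : deriv φ = fun y => R y * p y := funext fun y => (hφR y).deriv
  refine ⟨c, φ, r, hc, ⟨hφ0, hVc, ?_, ?_, ?_⟩, ?_, ?_, ?_⟩
  · have hQc : Continuous fun y => Q y * φ y := hQ0.continuous.mul
      (continuous_iff_continuousAt.2 fun y => (hφR y).continuousAt)
    have hp1 : ContDiff ℝ 1 p := by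
      rw [contDiff_one_iff_deriv]
      refine ⟨fun y => (hpQ y).differentiableAt, ?_⟩
      rwa [show deriv p = fun y => Q y * φ y from funext fun y => (hpQ y).deriv]
    have hRc : ContDiff ℝ 1 R :=
      (Complex.ofRealCLM.contDiff.comp (hρ.of_le (by norm_num))).inv hρne
    rw [show (2 : WithTop ℕ∞) = 1 + 1 by norm_num, contDiff_succ_iff_deriv]
    refine ⟨fun y => (hφR y).differentiableAt, by simp, ?_⟩
    rw [hderivφ]
    exact hRc.mul hp1
  · intro y
    have h1 : (fun z : ℝ => (ρ₀ z : ℂ) * deriv φ z) = p := by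
      rw [hderivφ]
      ext z
      have := hρne z
      simp only [hR]
      field_simp
    have h2 : deriv (fun z : ℝ => ρ₀ z * deriv (fun y => ε * U y) z) y = ε * F₁ y := by
      have h3 : (fun z : ℝ => ρ₀ z * deriv (fun y => ε * U y) z) =
          fun z => ε * (ρ₀ z * deriv U z) := by
        ext z
        rw [((hUd z).const_mul ε).deriv]
        ring
      rw [h3, ((hF₁d y).const_mul ε).deriv]
    rw [h1, (hpQ y).deriv, h2]
    simp only [hQ, hw, div_eq_mul_inv, pow_two, mul_inv]
    push_cast
    ring
  · intro y
    have := hVc y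
    simp only [hr, hw]
    field_simp
    ring
  · have h1 : InSobolev ((0 + 1 : ℕ) : ℝ) φ := by
      have := inSobolev_of_system hφ2 hp2 hφR hpQ hQ0 hR1.of_succ (BoundedDerivs.const 1)
        (BoundedDerivs.const 0)
      rwa [hφform] at this
    have h2 : InSobolev ((0 + 1 : ℕ) : ℝ) (fun y => R y * p y) := by
      have := inSobolev_of_system hφ2 hp2 hφR hpQ hQ0 hR1.of_succ (BoundedDerivs.const 0) hR1
      simpa using this
    have h3 := h1.add_one h2 hφR
    norm_num at h3
    exact h3
  · have := inSobolev_of_system hφ2 hp2 hφR hpQ hQ0 hR1.of_succ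
      (hrcoef hρ1BD (hwBD hU0BD)) (BoundedDerivs.const 0)
    rw [hrform] at this
    simpa using this
  · intro hUs hρs m hm
    have hUB := BoundedDerivs.of_smoothWithBoundedDerivs hUs
    have hρB := BoundedDerivs.of_smoothWithBoundedDerivs hρs
    set n := ⌈m⌉₊ with hn
    have hmn : m ≤ ((n + 1 : ℕ) : ℝ) := (Nat.le_ceil m).trans (by push_cast; linarith)
    have hF₁B : BoundedDerivs n (fun y => (F₁ y : ℂ)) := by
      have h1 : BoundedDerivs n (fun y => ((deriv (deriv U) y : ℝ) : ℂ)) := by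
        have := (hUB (n + 1)).2.2
        rwa [show deriv (fun y => ((deriv U y : ℝ) : ℂ)) =
          fun y => ((deriv (deriv U) y : ℝ) : ℂ) from
            funext fun y => (hdUd y).ofReal_comp.deriv] at this
      have := ((hρB n).mul (hUB n)).add ((hρBD (hρB n)).of_succ.mul h1)
      simpa [hF₁] using this
    have hQB := hQBD (hρB n) (hUB n) hF₁B
    have hRB := (hRBD (hρB n)).of_succ
    constructor
    · have := inSobolev_of_system hφ2 hp2 hφR hpQ hQB hRB (BoundedDerivs.const 1)
        (BoundedDerivs.const 0)
      rw [hφform] at this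
      exact this.mono hmn
    · have := inSobolev_of_system hφ2 hp2 hφR hpQ hQB hRB (hrcoef (hρB _) (hwBD (hUB n)))
        (BoundedDerivs.const 0)
      rw [hrform] at this
      exact this.mono hmn
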